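/- **Setting.** For $x\in\mathbb R^3$ let $[x]_\times$ be the skew-symmetric matrix with $[x]_\times y=x\times y$, and let $[\cdot]_\otimes$ be the inverse map. Write $\langle\langle A,B\rangle\rangle=\mathrm{tr}(A^\top B)$, $\|A\|_F^2=\langle\langle A,A\rangle\rangle$, and $|X|_I^2=\tfrac18\|I-X\|_F^2$ for $X\in SO(3)$; $\nabla$ is the gradient on $SO(3)$ for the metric $\langle X\Omega_1,X\Omega_2\rangle_X=\langle\langle\Omega_1,\Omega_2\rangle\rangle$. The attitude $R(t)\in SO(3)$, $t\ge t_0\ge 0$, satisfies $\dot R=R[\omega]_\times$, and $\omega_y=\omega+b_\omega$ is measured, with a constant unknown bias $b_\omega\in\mathbb R^3$. Let $\mathcal Q$ be a finite index set, and put $\tilde R=R\hat R^\top$, $\tilde b_\omega=b_\omega-\hat b_\omega$. The hybrid observer with state $(\hat R,\hat b_\omega,q)\in SO(3)\times\mathbb R^3\times\mathcal Q$ and gains $\gamma_P,\gamma_I>0$ flows, while $(\tilde R,q)\in\mathcal F$, by $$\dot{\hat R}=\hat R[\omega_y-\hat b_\omega+\gamma_P\beta]_\times,\quad \dot{\hat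 b}_\omega=-\gamma_I\beta,\quad \dot q=0,\quad \beta=\hat R^\top[\tilde R^\top\nabla\Phi(\tilde R,q)]_\otimes ,$$ and, when $(\tilde R,q)\in\mathcal J$, may jump by $q^+\in\arg\min_{p\in\mathcal Q}\Phi(\tilde R,p)$, with $\hat R,\hat b_\omega$ unchanged, where for a given $\delta>0$ $$\mathcal F=\{(X,q):\Phi(X,q)-\min_p\Phi(X,p)\le\delta\},\qquad \mathcal J=\{(X,q):\Phi(X,q)-\min_p\Phi(X,p)\ge\delta\}.$$ Here $\Phi:SO(3)\times\mathcal Q\to[0,\infty)$ is a potential function on a set $\mathcal D\subseteq SO(3)\times\mathcal Q$ containing $\{I\}\times\mathcal Q$: each $\Phi(\cdot,q)$ is continuous, $\Phi(X,q)=0$ iff $X=I$, and $\Phi(\cdot,q)$ is differentiable with continuous gradient on $\{X:(X,q)\in\mathcal D\}$. Solutions are hybrid arcs $(t,j)\mapsto(\hat R,\hat b_\omega,q)(t,j)$ on hybrid time domains starting at $(t_0,0)$, locally absolutely continuous in $t$, satisfying the differential equations almost everywhere; a solution is complete if its hybrid time domain is unbounded. **Theorem 1.** Suppose that $\mathcal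 F\subseteq\mathcal D$ and that for some constants $\alpha_1,\dots,\alpha_4>0$ $$\alpha_1|X|_I^2\le\Phi(X,q)\le\alpha_2|X|_I^2\quad\forall (X,q)\in SO(3)\times\mathcal Q,$$ $$\alpha_3|X|_I^2\le\|\nabla\Phi(X,q)\|_F^2\le\alpha_4|X|_I^2\quad\forall (X,q)\in\mathcal F,$$ and that $\omega$ is bounded. Then every solution has finitely many jumps, and the equilibrium $e=0$ of the error $e=(|\tilde R|_I,\|\tilde b_\omega\|)^\top$ is globally exponentially stable, uniformly in the initial time and in initial errors from bounded sets. Precisely: there is $k>0$ such that for all $r,c$ there are $N\in\mathbb N$ and $\lambda>0$ such that for every $\omega$ with $\sup_{t\ge0}\|\omega(t)\|\le c$, every $b_\omega$, every $t_0\ge0$, every attitude trajectory $R$ and every solution from time $t_0$ with $\|e(t_0,0)\|\le |r|$, the solution has at most $N$ jumps, $$\|e(t,j)\|^2\le k\,e^{-\lambda(t-t_0+j)}\,\|e(t_0,0)\|^2\quad\text{for all }(t,j)\text{ in its domain},$$ and, if it is maximal (not extendable), it is complete. -/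

import Mathlib

open Matrix Filter Topology Asymptotics MeasureTheory

namespace HybridObserver

noncomputable section

/-- The rotation group `SO(3)` of real orthogonal `3 × 3` matrices of determinant one, with the
topology induced from the space of matrices. -/
abbrev SO3 : Type := specialOrthogonalGroup (Fin 3) ℝ

/-- Real `3 × 3` matrices. -/
abbrev Mat3 : Type := Matrix (Fin 3) (Fin 3) ℝ

/-- The Frobenius inner product `⟨⟨A, B⟩⟩ = tr(Aᵀ B)`. -/
def frobInner (A B : Mat3) : ℝ := (Aᵀ * B).trace

/-- The Frobenius norm `‖A‖_F = √⟨⟨A, A⟩⟩`. -/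
def frobNorm (A : Mat3) : ℝ := Real.sqrt (frobInner A A)

/-- The Euclidean norm of a vector of `ℝ³`. -/
def euclNorm (v : Fin 3 → ℝ) : ℝ := Real.sqrt (v ⬝ᵥ v)

/-- The normalized distance of a rotation to the identity, `|X|_I² = ‖I - X‖_F² / 8`. -/
def attNorm (X : SO3) : ℝ := Real.sqrt (frobNorm (1 - (X : Mat3)) ^ 2 / 8)

/-- The map `[·]_×` from `ℝ³` to the skew-symmetric matrices. -/
def hat (x : Fin 3 → ℝ) : Mat3 :=
  !![0, -x 2, x 1; x 2, 0, -x 0; -x 1, x 0, 0]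

/-- The map `[·]_⊗`, inverse to `[·]_×` on the skew-symmetric matrices. -/
def vee (A : Mat3) : Fin 3 → ℝ := ![A 2 1, A 0 2, A 1 0]

theorem hat_mulVec (x y : Fin 3 → ℝ) : hat x *ᵥ y = crossProduct x y := by
  ext i
  fin_cases i <;> simp [hat, crossProduct, Matrix.mulVec, dotProduct, Fin.sum_univ_three] <;> ring

theorem vee_hat (x : Fin 3 → ℝ) : vee (hat x) = x := by
  ext i
  fin_cases i <;> simp [hat, vee]

theorem hat_vee (A : Mat3) (hA : Aᵀ = -A) : hat (vee A) = A := by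
  have h : ∀ i j, A j i = -A i j := fun i j => by
    have := congrFun (congrFun hA i) j
    simpa using this
  ext i j
  fin_cases i <;> fin_cases j <;> simp [hat, vee] <;>
    linarith [h 0 0, h 1 1, h 2 2, h 0 1, h 0 2, h 1 2]

/-- The tangent space `T_X SO(3) = {X Ω | Ωᵀ = -Ω}`. -/
def tangentSO3 (X : SO3) : Set Mat3 := {G | ∃ Ω : Mat3, Ωᵀ = -Ω ∧ G = (X : Mat3) * Ω}

/-- `f` is differentiable at `X` on the manifold `SO(3)`, with gradient `G ∈ T_X SO(3)` relative to
the metric `⟨X Ω₁, X Ω₂⟩_X = ⟨⟨Ω₁, Ω₂⟩⟩`, which is the one induced by the Frobenius inner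
product. -/
def HasGradSO3 (f : SO3 → ℝ) (G : Mat3) (X : SO3) : Prop :=
  G ∈ tangentSO3 X ∧
    (fun Y : SO3 => f Y - f X - frobInner G ((Y : Mat3) - (X : Mat3)))
      =o[𝓝 X] fun Y : SO3 => frobNorm ((Y : Mat3) - (X : Mat3))

/-- Differentiability at a point of `SO(3)`. -/
def DiffAtSO3 (f : SO3 → ℝ) (X : SO3) : Prop := ∃ G, HasGradSO3 f G X

open Classical in
/-- The gradient of `f` at `X` (zero where `f` is not differentiable). -/
def gradSO3 (f : SO3 → ℝ) (X : SO3) : Mat3 :=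
  if h : DiffAtSO3 f X then h.choose else 0

variable {Q : Type*}

/-- The set of potential functions on `D` with respect to `{I} × Q`. -/
structure IsPotential (D : Set (SO3 × Q)) (Φ : SO3 → Q → ℝ) : Prop where
  identity_mem : ∀ q, ((1 : SO3), q) ∈ D
  continuous : ∀ q, Continuous fun X => Φ X q
  pos : ∀ X q, X ≠ 1 → 0 < Φ X q
  zero : ∀ q, Φ 1 q = 0
  diff : ∀ X q, (X, q) ∈ D → DiffAtSO3 (fun Y => Φ Y q) X
  grad_continuousOn : ∀ q, ContinuousOn (gradSO3 fun Y => Φ Y q) {X | (X, q) ∈ D}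

/-- The flow set: `Φ(X, q) - min_p Φ(X, p) ≤ δ`. -/
def flowSet (Φ : SO3 → Q → ℝ) (δ : ℝ) : Set (SO3 × Q) :=
  {x | Φ x.1 x.2 - (⨅ p, Φ x.1 p) ≤ δ}

/-- The jump set: `Φ(X, q) - min_p Φ(X, p) ≥ δ`. -/
def jumpSet (Φ : SO3 → Q → ℝ) (δ : ℝ) : Set (SO3 × Q) :=
  {x | δ ≤ Φ x.1 x.2 - (⨅ p, Φ x.1 p)}

/-- The design data of the observer: the indexed potential function, the two gains and the
hysteresis gap. -/
structure Design (Q : Type*) where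
  Φ : SO3 → Q → ℝ
  γP : ℝ
  γI : ℝ
  δ : ℝ

/-- The innovation term `β = R̂ᵀ [R̃ᵀ ∇Φ(R̃, q)]_⊗`. -/
def innovation (Φ : SO3 → Q → ℝ) (Rt Rh : SO3) (q : Q) : Fin 3 → ℝ :=
  (Rh : Mat3)ᵀ *ᵥ vee ((Rt : Mat3)ᵀ * gradSO3 (fun Y => Φ Y q) Rt)

/-- Local absolute continuity on `I` of a curve in a space of coordinates, coordinate by
coordinate. -/
def LocAC {ι : Type*} (I : Set ℝ) (f : ℝ → ι → ℝ) : Prop :=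
  ∀ i, ∀ a ∈ I, ∀ b ∈ I, AbsolutelyContinuousOnInterval (fun t => f t i) a b

/-- `R` is an attitude trajectory on `[t₀, ∞)` with angular velocity `ω`: it is locally absolutely
continuous and `Ṙ = R [ω]_×` almost everywhere. -/
structure IsAttitude (t₀ : ℝ) (ω : ℝ → Fin 3 → ℝ) (R : ℝ → SO3) : Prop where
  ac : LocAC (Set.Ici t₀) fun t (ij : Fin 3 × Fin 3) => (R t : Mat3) ij.1 ij.2
  deriv : ∀ᵐ t : ℝ, t₀ < t → ∀ i k,
    HasDerivAt (fun s => (R s : Mat3) i k) (((R t : Mat3) * hat (ω t)) i k) t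

/-- Hybrid time domains with initial time `t₀`: unions of intervals `[τ j, τ (j+1)] × {j}` with
`t₀ = τ 0 ≤ τ 1 ≤ …`, infinitely many, or finitely many with a last interval that may be closed,
half-open or unbounded. -/
def IsHybridTimeDomain (t₀ : ℝ) (E : Set (ℝ × ℕ)) : Prop :=
  ∃ τ : ℕ → ℝ, Monotone τ ∧ τ 0 = t₀ ∧
    (E = {p | p.1 ∈ Set.Icc (τ p.2) (τ (p.2 + 1))} ∨
      ∃ (J : ℕ) (I : Set ℝ),
        (I = Set.Icc (τ J) (τ (J + 1)) ∨ (τ J < τ (J + 1) ∧ I = Set.Ico (τ J) (τ (J + 1))) ∨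
          I = Set.Ici (τ J)) ∧
        E = {p | (p.2 < J ∧ p.1 ∈ Set.Icc (τ p.2) (τ (p.2 + 1))) ∨ (p.2 = J ∧ p.1 ∈ I)})

/-- The observer state along hybrid time: attitude estimate, bias estimate and switching variable.
Only the values on `dom` matter. -/
structure Arc (Q : Type*) where
  dom : Set (ℝ × ℕ)
  Rh : ℝ → ℕ → SO3
  bh : ℝ → ℕ → Fin 3 → ℝ
  q : ℝ → ℕ → Q

namespace Arc

/-- The time interval `I_j = {t | (t, j) ∈ dom}`. -/
def slice (x : Arc Q) (j : ℕ) : Set ℝ := {t | (t, j) ∈ x.dom}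

/-- The attitude estimation error `R̃ = R R̂ᵀ` (the inverse in `SO(3)` is the transpose). -/
def Rt (x : Arc Q) (R : ℝ → SO3) (t : ℝ) (j : ℕ) : SO3 := R t * (x.Rh t j)⁻¹

/-- The squared Euclidean norm of `e = (|R̃|_I, ‖b - b̂‖)`. -/
def errSq (x : Arc Q) (R : ℝ → SO3) (b : Fin 3 → ℝ) (t : ℝ) (j : ℕ) : ℝ :=
  attNorm (x.Rt R t j) ^ 2 + euclNorm (b - x.bh t j) ^ 2

/-- `y` extends `x`. -/
def Extends (y x : Arc Q) : Prop :=
  x.dom ⊆ y.dom ∧ ∀ p ∈ x.dom,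
    y.Rh p.1 p.2 = x.Rh p.1 p.2 ∧ y.bh p.1 p.2 = x.bh p.1 p.2 ∧ y.q p.1 p.2 = x.q p.1 p.2

/-- The hybrid time domain is unbounded. -/
def Complete (x : Arc Q) : Prop := ∀ M : ℝ, ∃ p ∈ x.dom, M ≤ p.1 + p.2

end Arc

theorem coe_inv_SO3 (X : SO3) : ((X⁻¹ : SO3) : Mat3) = (X : Mat3)ᵀ := rfl

/-- `x` is a solution, from initial time `t₀`, of the hybrid observer driven by the true attitude
`R` and by the biased angular velocity measurement `ω + b`. -/
structure IsSolution (P : Design Q) (t₀ : ℝ) (ω : ℝ → Fin 3 → ℝ) (b : Fin 3 → ℝ) (R : ℝ → SO3)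
    (x : Arc Q) : Prop where
  dom : IsHybridTimeDomain t₀ x.dom
  ac_Rh : ∀ j, LocAC (x.slice j) fun t (ij : Fin 3 × Fin 3) => (x.Rh t j : Mat3) ij.1 ij.2
  ac_bh : ∀ j, LocAC (x.slice j) fun t => x.bh t j
  flow_mem : ∀ j, ∀ t ∈ interior (x.slice j), (x.Rt R t j, x.q t j) ∈ flowSet P.Φ P.δ
  flow_Rh : ∀ j, ∀ᵐ t : ℝ, t ∈ interior (x.slice j) → ∀ i k,
    HasDerivAt (fun s => (x.Rh s j : Mat3) i k)
      (((x.Rh t j : Mat3) * hat ((ω t + b) - x.bh t j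
        + P.γP • innovation P.Φ (x.Rt R t j) (x.Rh t j) (x.q t j))) i k) t
  flow_bh : ∀ j, ∀ᵐ t : ℝ, t ∈ interior (x.slice j) → ∀ i,
    HasDerivAt (fun s => x.bh s j i)
      ((-(P.γI • innovation P.Φ (x.Rt R t j) (x.Rh t j) (x.q t j))) i) t
  flow_q : ∀ j, ∀ s ∈ x.slice j, ∀ t ∈ x.slice j, x.q s j = x.q t j
  jump_mem : ∀ t j, (t, j) ∈ x.dom → (t, j + 1) ∈ x.dom →
    (x.Rt R t j, x.q t j) ∈ jumpSet P.Φ P.δ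
  jump_Rh : ∀ t j, (t, j) ∈ x.dom → (t, j + 1) ∈ x.dom → x.Rh t (j + 1) = x.Rh t j
  jump_bh : ∀ t j, (t, j) ∈ x.dom → (t, j + 1) ∈ x.dom → x.bh t (j + 1) = x.bh t j
  jump_q : ∀ t j, (t, j) ∈ x.dom → (t, j + 1) ∈ x.dom →
    ∀ p, P.Φ (x.Rt R t j) (x.q t (j + 1)) ≤ P.Φ (x.Rt R t j) p

/-- A solution is maximal if it has no extension to a larger hybrid time domain. -/
def IsMaximal (P : Design Q) (t₀ : ℝ) (ω : ℝ → Fin 3 → ℝ) (b : Fin 3 → ℝ) (R : ℝ → SO3)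
    (x : Arc Q) : Prop :=
  ∀ y : Arc Q, IsSolution P t₀ ω b R y → y.Extends x → y.dom = x.dom

end

end HybridObserver

open HybridObserver

/-!
Along a solution let `b̃ = b - b̂`, let `β` be the innovation, and let `n` be the distance of the
attitude error `R̃` to the identity. On flows the energy `Φ + ‖b̃‖² / γI` has derivative `-2 γP ‖β‖²`
(`IsRun.hasDerivAt_flow`), and at a jump it drops by at least `δ`. Hence the number of jumps and the
bias error are bounded in terms of the initial error alone (`energy_le`).

The energy does not decay strictly in `b̃`. Its sum with a small multiple `μ` of the cross term
`½ ⟨⟨[b̃]_×, R̂ᵀ R⟩⟩` does: replacing `R̂ᵀ R` by the identity in the derivative of the cross term leaves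
`-‖b̃‖²`, and every other term is bounded by a multiple of `n ‖b̃‖ + n²` (`cross_term_deriv_le`), which
the decay `-γP α₃ n²` of the energy absorbs for small `μ` (`exists_lyapunov_decay`). How small `μ` and
the rate must be depends on the bounds on `b̃` and `ω`, but as `μ` is also kept below a threshold fixed
by the design, the overshoot does not (`exists_errSq_decay`). The cross term is not affected by
jumps, since `R̂` and `b̂` do not jump.

Both functions are absolutely continuous along flows although `Φ` is only differentiable on a set
that need not be open: bounded angular velocity makes `R̃` Lipschitz in time, and a function that is
differentiable with bounded gradient at every point of a Lipschitz curve is Lipschitz along it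
(`abs_sub_le_of_hasGradSO3`).

A maximal solution with bounded domain would have a last flow interval. If it is half-open, the
estimates, being Lipschitz, have limits at its right end; if it is compact, the solution ends in the
jump set and can jump, or it ends outside and can flow further. For the latter, the equations are
written in `R̃` and `b̃`: the merely bounded `ω` disappears, the right-hand side becomes continuous,
and Peano's theorem (`exists_local_solution`) applies, after a Tietze extension of the gradient to
all matrices. The solution stays in `SO(3)` because `R̃ R̃ᵀ` is constant (`exists_local_flow`).
-/

namespace HybridObserver

section

variable {Q : Type*}

/-! ### Frobenius inner product, hat map and rotations -/

theorem frobInner_eq_sum (A B : Mat3) : frobInner A B = ∑ i, ∑ j, A i j * B i j := by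
  simp only [frobInner, Matrix.trace, Matrix.diag, Matrix.mul_apply, Matrix.transpose_apply]
  exact Finset.sum_comm

theorem frobInner_self_nonneg (A : Mat3) : 0 ≤ frobInner A A := by
  rw [frobInner_eq_sum]
  exact Finset.sum_nonneg fun i _ => Finset.sum_nonneg fun j _ => mul_self_nonneg _

theorem frobNorm_sq (A : Mat3) : frobNorm A ^ 2 = frobInner A A :=
  Real.sq_sqrt (frobInner_self_nonneg A)

theorem frobNorm_nonneg (A : Mat3) : 0 ≤ frobNorm A := Real.sqrt_nonneg _

section FrobeniusInstance

attribute [local instance] Matrix.frobeniusNormedAddCommGroup Matrix.frobeniusNormedSpace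

theorem frobNorm_eq_norm (A : Mat3) : frobNorm A = ‖A‖ := by
  rw [frobNorm, frobInner_eq_sum, Matrix.frobenius_norm_def, Real.sqrt_eq_rpow]
  simp [pow_two]

theorem frobNorm_mul_le (A B : Mat3) : frobNorm (A * B) ≤ frobNorm A * frobNorm B := by
  simpa only [frobNorm_eq_norm] using Matrix.frobenius_norm_mul A B

theorem frobNorm_add_le (A B : Mat3) : frobNorm (A + B) ≤ frobNorm A + frobNorm B := by
  simpa only [frobNorm_eq_norm] using norm_add_le A B

theorem frobNorm_sub_le (A B : Mat3) : frobNorm (A - B) ≤ frobNorm A + frobNorm B := by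
  simpa only [frobNorm_eq_norm] using norm_sub_le A B

theorem frobNorm_sub_comm (A B : Mat3) : frobNorm (A - B) = frobNorm (B - A) := by
  simpa only [frobNorm_eq_norm] using norm_sub_rev A B

theorem frobNorm_transpose (A : Mat3) : frobNorm Aᵀ = frobNorm A := by
  simpa only [frobNorm_eq_norm] using Matrix.frobenius_norm_transpose A

end FrobeniusInstance

theorem abs_frobInner_le (A B : Mat3) : |frobInner A B| ≤ frobNorm A * frobNorm B := by
  refine abs_le_of_sq_le_sq ?_ (mul_nonneg (frobNorm_nonneg A) (frobNorm_nonneg B))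
  rw [mul_pow, frobNorm_sq, frobNorm_sq]
  simp only [frobInner_eq_sum, ← Fintype.sum_prod_type', ← pow_two]
  exact Finset.sum_mul_sq_le_sq_mul_sq _ _ _

theorem abs_entry_le_frobNorm (A : Mat3) (i j : Fin 3) : |A i j| ≤ frobNorm A := by
  rw [frobNorm, frobInner_eq_sum]
  refine Real.abs_le_sqrt ?_
  rw [pow_two]
  exact (Finset.single_le_sum (f := fun j => A i j * A i j)
    (fun j _ => mul_self_nonneg (A i j)) (Finset.mem_univ j)).trans
    (Finset.single_le_sum (f := fun i => ∑ j, A i j * A i j)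
      (fun i _ => Finset.sum_nonneg fun j _ => mul_self_nonneg (A i j)) (Finset.mem_univ i))

theorem frobNorm_le_of_entry_le {A : Mat3} {c : ℝ} (h : ∀ i j, |A i j| ≤ c) :
    frobNorm A ≤ 3 * c := by
  have hc : 0 ≤ c := (abs_nonneg _).trans (h 0 0)
  refine Real.sqrt_le_iff.2 ⟨by positivity, ?_⟩
  have h2 : ∀ i j, A i j * A i j ≤ c ^ 2 := fun i j => by
    rw [← pow_two]; exact sq_le_sq' (abs_le.1 (h i j)).1 (abs_le.1 (h i j)).2
  calc frobInner A A = ∑ i, ∑ j, A i j * A i j := frobInner_eq_sum A A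
    _ ≤ ∑ _i : Fin 3, ∑ _j : Fin 3, c ^ 2 :=
        Finset.sum_le_sum fun i _ => Finset.sum_le_sum fun j _ => h2 i j
    _ = (3 * c) ^ 2 := by simp; ring

theorem euclNorm_sq (v : Fin 3 → ℝ) : euclNorm v ^ 2 = v ⬝ᵥ v := by
  refine Real.sq_sqrt ?_
  simp only [dotProduct]
  exact Finset.sum_nonneg fun i _ => mul_self_nonneg _

theorem euclNorm_nonneg (v : Fin 3 → ℝ) : 0 ≤ euclNorm v := Real.sqrt_nonneg _

theorem euclNorm_eq_norm (v : Fin 3 → ℝ) : euclNorm v = ‖WithLp.toLp 2 v‖ := by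
  rw [euclNorm, EuclideanSpace.norm_eq]
  simp [dotProduct, pow_two]

theorem euclNorm_add_le (u v : Fin 3 → ℝ) : euclNorm (u + v) ≤ euclNorm u + euclNorm v := by
  simpa only [euclNorm_eq_norm, WithLp.toLp_add] using norm_add_le (WithLp.toLp 2 u) (WithLp.toLp 2 v)

theorem euclNorm_smul (c : ℝ) (v : Fin 3 → ℝ) : euclNorm (c • v) = |c| * euclNorm v := by
  simpa only [euclNorm_eq_norm, WithLp.toLp_smul, Real.norm_eq_abs] using norm_smul c (WithLp.toLp 2 v)

theorem abs_dotProduct_le (u v : Fin 3 → ℝ) : |u ⬝ᵥ v| ≤ euclNorm u * euclNorm v := by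
  have h := Finset.sum_mul_sq_le_sq_mul_sq (Finset.univ : Finset (Fin 3)) u v
  simp only [pow_two (u _), pow_two (v _)] at h
  change (u ⬝ᵥ v) ^ 2 ≤ (u ⬝ᵥ u) * (v ⬝ᵥ v) at h
  rw [← euclNorm_sq, ← euclNorm_sq, ← mul_pow] at h
  exact abs_le_of_sq_le_sq h (mul_nonneg (euclNorm_nonneg u) (euclNorm_nonneg v))

theorem abs_coord_le_euclNorm (v : Fin 3 → ℝ) (i : Fin 3) : |v i| ≤ euclNorm v := by
  refine Real.abs_le_sqrt ?_
  rw [pow_two]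
  exact Finset.single_le_sum (f := fun i => v i * v i)
    (fun i _ => mul_self_nonneg (v i)) (Finset.mem_univ i)

theorem euclNorm_le_of_coord_le {v : Fin 3 → ℝ} {c : ℝ} (h : ∀ i, |v i| ≤ c) :
    euclNorm v ≤ 2 * c := by
  have hc : 0 ≤ c := (abs_nonneg _).trans (h 0)
  refine Real.sqrt_le_iff.2 ⟨by positivity, ?_⟩
  have h2 : ∀ i, v i * v i ≤ c ^ 2 := fun i => by
    rw [← pow_two]; exact sq_le_sq' (abs_le.1 (h i)).1 (abs_le.1 (h i)).2
  simp only [dotProduct, Fin.sum_univ_three]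
  nlinarith [h2 0, h2 1, h2 2]

theorem hat_add (u v : Fin 3 → ℝ) : hat (u + v) = hat u + hat v := by
  ext i j; fin_cases i <;> fin_cases j <;> simp [hat] <;> ring

theorem hat_transpose (v : Fin 3 → ℝ) : (hat v)ᵀ = -hat v := by
  ext i j; fin_cases i <;> fin_cases j <;> simp [hat]

theorem frobInner_hat_hat (u v : Fin 3 → ℝ) : frobInner (hat u) (hat v) = 2 * (u ⬝ᵥ v) := by
  rw [frobInner_eq_sum]
  simp [hat, Fin.sum_univ_three, dotProduct]
  ring

theorem frobInner_hat_one (u : Fin 3 → ℝ) : frobInner (hat u) 1 = 0 := by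
  rw [frobInner_eq_sum]
  simp [hat, Fin.sum_univ_three]

theorem frobNorm_hat (v : Fin 3 → ℝ) : frobNorm (hat v) = Real.sqrt 2 * euclNorm v := by
  rw [frobNorm, frobInner_hat_hat, euclNorm, Real.sqrt_mul zero_le_two]

/-- Conjugation by a matrix turns `[M v]_×` into the multiple `det M` of `[v]_×`. -/
theorem transpose_mul_hat_mul (M : Mat3) (v : Fin 3 → ℝ) :
    Mᵀ * hat (M *ᵥ v) * M = M.det • hat v := by
  ext i j
  rw [Matrix.det_fin_three]
  fin_cases i <;> fin_cases j <;>
    simp [hat, Matrix.mul_apply, Matrix.mulVec, dotProduct, Fin.sum_univ_three] <;> ring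

section Rotations

variable (X : SO3)

theorem SO3.mul_transpose : (X : Mat3) * (X : Mat3)ᵀ = 1 :=
  (Matrix.mem_orthogonalGroup_iff (Fin 3) ℝ).1 (Matrix.mem_specialOrthogonalGroup_iff.1 X.2).1

theorem SO3.transpose_mul : (X : Mat3)ᵀ * (X : Mat3) = 1 :=
  (Matrix.mem_orthogonalGroup_iff' (Fin 3) ℝ).1 (Matrix.mem_specialOrthogonalGroup_iff.1 X.2).1

theorem SO3.det_eq_one : (X : Mat3).det = 1 := (Matrix.mem_specialOrthogonalGroup_iff.1 X.2).2

theorem mem_SO3_iff {A : Mat3} :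
    A ∈ specialOrthogonalGroup (Fin 3) ℝ ↔ A * Aᵀ = 1 ∧ A.det = 1 := by
  rw [Matrix.mem_specialOrthogonalGroup_iff, Matrix.mem_orthogonalGroup_iff]

theorem SO3.transpose_mul_cancel_left (A : Mat3) : (X : Mat3)ᵀ * ((X : Mat3) * A) = A := by
  rw [← Matrix.mul_assoc, SO3.transpose_mul, Matrix.one_mul]

theorem SO3.mul_transpose_cancel_left (A : Mat3) : (X : Mat3) * ((X : Mat3)ᵀ * A) = A := by
  rw [← Matrix.mul_assoc, SO3.mul_transpose, Matrix.one_mul]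

theorem SO3.frobInner_mul_left (A B : Mat3) :
    frobInner ((X : Mat3) * A) ((X : Mat3) * B) = frobInner A B := by
  rw [frobInner, frobInner, Matrix.transpose_mul, Matrix.mul_assoc, SO3.transpose_mul_cancel_left]

theorem frobInner_transpose (A B : Mat3) : frobInner Aᵀ Bᵀ = frobInner A B := by
  rw [frobInner_eq_sum, frobInner_eq_sum, Finset.sum_comm]; rfl

theorem SO3.frobInner_mul_right (A B : Mat3) :
    frobInner (A * (X : Mat3)) (B * (X : Mat3)) = frobInner A B := by
  rw [← frobInner_transpose, Matrix.transpose_mul, Matrix.transpose_mul, ← coe_inv_SO3,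
    SO3.frobInner_mul_left, frobInner_transpose]

theorem SO3.frobNorm_mul_left (A : Mat3) : frobNorm ((X : Mat3) * A) = frobNorm A := by
  rw [frobNorm, frobNorm, SO3.frobInner_mul_left]

theorem SO3.frobNorm_mul_right (A : Mat3) : frobNorm (A * (X : Mat3)) = frobNorm A := by
  rw [frobNorm, frobNorm, SO3.frobInner_mul_right]

theorem SO3.frobNorm_mul_transpose (A : Mat3) : frobNorm (A * (X : Mat3)ᵀ) = frobNorm A := by
  rw [← coe_inv_SO3, SO3.frobNorm_mul_right]

theorem SO3.hat_transpose_mulVec (v : Fin 3 → ℝ) :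
    hat ((X : Mat3)ᵀ *ᵥ v) = (X : Mat3)ᵀ * hat v * (X : Mat3) := by
  have h := transpose_mul_hat_mul (X : Mat3) ((X : Mat3)ᵀ *ᵥ v)
  rw [Matrix.mulVec_mulVec, SO3.mul_transpose, Matrix.one_mulVec, SO3.det_eq_one, one_smul] at h
  exact h.symm

theorem SO3.frobNorm_eq : frobNorm (X : Mat3) = Real.sqrt 3 := by
  rw [frobNorm, frobInner, SO3.transpose_mul]; simp

theorem attNorm_nonneg : 0 ≤ attNorm X := Real.sqrt_nonneg _

theorem frobNorm_one_sub_eq : frobNorm (1 - (X : Mat3)) = Real.sqrt 8 * attNorm X := by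
  rw [attNorm, ← Real.sqrt_mul (by norm_num), mul_div_cancel₀ _ (by norm_num),
    Real.sqrt_sq (frobNorm_nonneg _)]

theorem attNorm_le_two : attNorm X ≤ 2 := by
  refine Real.sqrt_le_iff.2 ⟨by norm_num, ?_⟩
  have h1 : frobNorm (1 - (X : Mat3)) ≤ Real.sqrt 3 + Real.sqrt 3 := by
    refine (frobNorm_sub_le _ _).trans (le_of_eq ?_)
    rw [SO3.frobNorm_eq X, ← SO3.frobNorm_eq 1]; rfl
  have h3 : Real.sqrt 3 ^ 2 = 3 := Real.sq_sqrt (by norm_num)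
  have h4 := pow_le_pow_left₀ (frobNorm_nonneg _) h1 2
  nlinarith

end Rotations

/-! ### The innovation term and the derivative of the Lyapunov function -/

theorem gradSO3_spec {f : SO3 → ℝ} {X : SO3} (h : DiffAtSO3 f X) :
    HasGradSO3 f (gradSO3 f X) X := by
  rw [gradSO3, dif_pos h]; exact h.choose_spec

theorem hat_vee_gradSO3 {f : SO3 → ℝ} {X : SO3} (h : DiffAtSO3 f X) :
    (X : Mat3) * hat (vee ((X : Mat3)ᵀ * gradSO3 f X)) = gradSO3 f X := by
  obtain ⟨Ω, hΩ, hG⟩ := (gradSO3_spec h).1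
  rw [hG, SO3.transpose_mul_cancel_left, hat_vee Ω hΩ]

/-- For `R̃ = R R̂ᵀ`, the gradient is `R [β]_× R̂ᵀ` with `β` the innovation. -/
theorem gradSO3_eq_innovation {Φ : SO3 → Q → ℝ} {R Rh : SO3} {q : Q}
    (h : DiffAtSO3 (fun Y => Φ Y q) (R * Rh⁻¹)) :
    gradSO3 (fun Y => Φ Y q) (R * Rh⁻¹) =
      (R : Mat3) * hat (innovation Φ (R * Rh⁻¹) Rh q) * (Rh : Mat3)ᵀ := by
  rw [innovation, SO3.hat_transpose_mulVec]
  conv_lhs => rw [← hat_vee_gradSO3 h]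
  have : ((R * Rh⁻¹ : SO3) : Mat3) = (R : Mat3) * (Rh : Mat3)ᵀ := rfl
  rw [this]
  simp only [Matrix.mul_assoc, SO3.mul_transpose, Matrix.mul_one]

theorem frobNorm_gradSO3_sq {Φ : SO3 → Q → ℝ} {R Rh : SO3} {q : Q}
    (h : DiffAtSO3 (fun Y => Φ Y q) (R * Rh⁻¹)) :
    frobNorm (gradSO3 (fun Y => Φ Y q) (R * Rh⁻¹)) ^ 2 =
      2 * euclNorm (innovation Φ (R * Rh⁻¹) Rh q) ^ 2 := by
  rw [gradSO3_eq_innovation h, SO3.frobNorm_mul_transpose, SO3.frobNorm_mul_left, frobNorm_sq,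
    frobInner_hat_hat, euclNorm_sq]

/-- Bound on the derivative of the cross term `½ ⟨⟨[b̃]_×, Y⟩⟩`, `Y = R̂ᵀ R`, along flows: the term
`-‖b̃‖²` comes from replacing `Y` by the identity, all others carry the factor `‖Y - I‖_F`. -/
theorem cross_term_deriv_le (Y : SO3) (v β w : Fin 3 → ℝ) (gP gI : ℝ) (hP : 0 ≤ gP) (hI : 0 ≤ gI) :
    (frobInner (hat (gI • β)) (Y : Mat3) +
      frobInner (hat v) ((Y : Mat3) * hat w - hat (w + v + gP • β) * (Y : Mat3))) / 2 ≤
    -euclNorm v ^ 2 + gP * euclNorm v * euclNorm β + 2 * gI * euclNorm β * attNorm Y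
      + 3 * (euclNorm v + gP * euclNorm β + 2 * euclNorm w) * euclNorm v * attNorm Y := by
  have hs2 : Real.sqrt 2 ^ 2 = 2 := Real.sq_sqrt (by norm_num)
  have hs8 : Real.sqrt 8 = 2 * Real.sqrt 2 := by
    rw [show (8 : ℝ) = 2 ^ 2 * 2 by norm_num, Real.sqrt_mul (by norm_num), Real.sqrt_sq (by norm_num)]
  have hs3 : Real.sqrt 8 ≤ 3 := Real.sqrt_le_iff.2 (by norm_num)
  set Z : Mat3 := (Y : Mat3) - 1 with hZ
  have hY : (Y : Mat3) = 1 + Z := by rw [hZ]; abel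
  have hZn : frobNorm Z = Real.sqrt 8 * attNorm Y := by
    rw [hZ, frobNorm_sub_comm, frobNorm_one_sub_eq]
  have hadd : ∀ A B C : Mat3, frobInner A (B + C) = frobInner A B + frobInner A C := by
    intro A B C; simp only [frobInner, Matrix.mul_add, Matrix.trace_add]
  have hsub : ∀ A B C : Mat3, frobInner A (B - C) = frobInner A B - frobInner A C := by
    intro A B C; simp only [frobInner, Matrix.mul_sub, Matrix.trace_sub]
  have key : frobInner (hat (gI • β)) (Y : Mat3) +
      frobInner (hat v) ((Y : Mat3) * hat w - hat (w + v + gP • β) * (Y : Mat3)) =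
      frobInner (hat (gI • β)) Z - 2 * (v ⬝ᵥ v) - 2 * gP * (v ⬝ᵥ β)
      - frobInner (hat v) (hat (v + gP • β) * Z)
      + (frobInner (hat v) (Z * hat w) - frobInner (hat v) (hat w * Z)) := by
    have e : (Y : Mat3) * hat w - hat (w + v + gP • β) * (Y : Mat3) =
        Z * hat w - hat w * Z - hat (v + gP • β) - hat (v + gP • β) * Z := by
      rw [hY, add_assoc w, hat_add w]; noncomm_ring
    rw [e, hY, hadd, frobInner_hat_one]
    simp only [hsub, frobInner_hat_hat, dotProduct_add, dotProduct_smul, smul_eq_mul]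
    ring
  have n1 : frobInner (hat (gI • β)) Z ≤ (Real.sqrt 2 * (gI * euclNorm β)) * (Real.sqrt 8 * attNorm Y) := by
    refine (le_abs_self _).trans ((abs_frobInner_le _ _).trans (le_of_eq ?_))
    rw [hZn, frobNorm_hat, euclNorm_smul, abs_of_nonneg hI]
  have n2 : -(v ⬝ᵥ β) ≤ euclNorm v * euclNorm β := (neg_le_abs _).trans (abs_dotProduct_le _ _)
  have hv := euclNorm_nonneg v
  have hβ := euclNorm_nonneg β
  have hw := euclNorm_nonneg w
  have hn := attNorm_nonneg Y
  have n3 : -frobInner (hat v) (hat (v + gP • β) * Z) ≤ (Real.sqrt 2 * euclNorm v) *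
      ((Real.sqrt 2 * (euclNorm v + gP * euclNorm β)) * (Real.sqrt 8 * attNorm Y)) := by
    refine (neg_le_abs _).trans ((abs_frobInner_le _ _).trans ?_)
    rw [frobNorm_hat]
    refine mul_le_mul_of_nonneg_left ((frobNorm_mul_le _ _).trans ?_) (by positivity)
    rw [hZn, frobNorm_hat]
    refine mul_le_mul_of_nonneg_right (mul_le_mul_of_nonneg_left ?_ (by positivity)) (by positivity)
    refine (euclNorm_add_le _ _).trans (le_of_eq ?_)
    rw [euclNorm_smul, abs_of_nonneg hP]
  have n4 : frobInner (hat v) (Z * hat w) ≤ (Real.sqrt 2 * euclNorm v) *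
      ((Real.sqrt 8 * attNorm Y) * (Real.sqrt 2 * euclNorm w)) := by
    refine (le_abs_self _).trans ((abs_frobInner_le _ _).trans ?_)
    rw [frobNorm_hat v, ← hZn, ← frobNorm_hat w]
    exact mul_le_mul_of_nonneg_left (frobNorm_mul_le _ _) (by positivity)
  have n5 : -frobInner (hat v) (hat w * Z) ≤ (Real.sqrt 2 * euclNorm v) *
      ((Real.sqrt 2 * euclNorm w) * (Real.sqrt 8 * attNorm Y)) := by
    refine (neg_le_abs _).trans ((abs_frobInner_le _ _).trans ?_)
    rw [frobNorm_hat v, ← hZn, ← frobNorm_hat w]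
    exact mul_le_mul_of_nonneg_left (frobNorm_mul_le _ _) (by positivity)
  have n6 : gP * (-(v ⬝ᵥ β)) ≤ gP * (euclNorm v * euclNorm β) := mul_le_mul_of_nonneg_left n2 hP
  have n7 : (euclNorm v + gP * euclNorm β + 2 * euclNorm w) * euclNorm v * attNorm Y * Real.sqrt 8
      ≤ (euclNorm v + gP * euclNorm β + 2 * euclNorm w) * euclNorm v * attNorm Y * 3 :=
    mul_le_mul_of_nonneg_left hs3 (by positivity)
  have m1 : (Real.sqrt 2 * (gI * euclNorm β)) * (Real.sqrt 8 * attNorm Y)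
      = 4 * (gI * euclNorm β * attNorm Y) := by
    rw [hs8]; linear_combination (2 * gI * euclNorm β * attNorm Y) * hs2
  have m2 : (Real.sqrt 2 * euclNorm v) *
      ((Real.sqrt 2 * (euclNorm v + gP * euclNorm β)) * (Real.sqrt 8 * attNorm Y)) =
      2 * (euclNorm v * (euclNorm v + gP * euclNorm β) * Real.sqrt 8 * attNorm Y) := by
    linear_combination (euclNorm v * (euclNorm v + gP * euclNorm β) * Real.sqrt 8 * attNorm Y) * hs2
  have m3 : (Real.sqrt 2 * euclNorm v) *
      ((Real.sqrt 2 * euclNorm w) * (Real.sqrt 8 * attNorm Y)) =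
      2 * (euclNorm v * euclNorm w * Real.sqrt 8 * attNorm Y) := by
    linear_combination (euclNorm v * euclNorm w * Real.sqrt 8 * attNorm Y) * hs2
  have m4 : (Real.sqrt 2 * euclNorm v) *
      ((Real.sqrt 8 * attNorm Y) * (Real.sqrt 2 * euclNorm w)) =
      2 * (euclNorm v * euclNorm w * Real.sqrt 8 * attNorm Y) := by
    linear_combination (euclNorm v * euclNorm w * Real.sqrt 8 * attNorm Y) * hs2
  rw [key, euclNorm_sq]
  rw [m1] at n1; rw [m2] at n3; rw [m4] at n4; rw [m3] at n5
  linarith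

theorem abs_cross_term_le (Y : SO3) (v : Fin 3 → ℝ) :
    |frobInner (hat v) (Y : Mat3) / 2| ≤ attNorm Y ^ 2 + euclNorm v ^ 2 := by
  have h1 : frobInner (hat v) (Y : Mat3) = frobInner (hat v) ((Y : Mat3) - 1) := by
    rw [frobInner, frobInner, Matrix.mul_sub, Matrix.trace_sub]
    change _ = _ - frobInner (hat v) 1
    rw [frobInner_hat_one, sub_zero]
  have h2 := abs_frobInner_le (hat v) ((Y : Mat3) - 1)
  rw [← h1, frobNorm_hat, frobNorm_sub_comm, frobNorm_one_sub_eq] at h2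
  have hs : Real.sqrt 2 * Real.sqrt 8 = 4 := by
    rw [← Real.sqrt_mul (by norm_num), show (2 : ℝ) * 8 = 4 ^ 2 by norm_num]
    exact Real.sqrt_sq (by norm_num)
  rw [abs_div, abs_two]
  have h3 : Real.sqrt 2 * euclNorm v * (Real.sqrt 8 * attNorm Y) = 4 * (euclNorm v * attNorm Y) := by
    linear_combination euclNorm v * attNorm Y * hs
  rw [h3] at h2
  nlinarith [sq_nonneg (attNorm Y - euclNorm v)]

/-- `|R̂ᵀ R|_I = |R R̂ᵀ|_I`. -/
theorem attNorm_inv_mul (R Rh : SO3) : attNorm (Rh⁻¹ * R) = attNorm (R * Rh⁻¹) := by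
  have h : frobNorm (1 - ((Rh⁻¹ * R : SO3) : Mat3)) = frobNorm (1 - ((R * Rh⁻¹ : SO3) : Mat3)) := by
    rw [← SO3.frobNorm_mul_left Rh, ← SO3.frobNorm_mul_transpose Rh]
    change frobNorm ((Rh : Mat3) * (1 - (Rh : Mat3)ᵀ * (R : Mat3)) * (Rh : Mat3)ᵀ) =
      frobNorm (1 - (R : Mat3) * (Rh : Mat3)ᵀ)
    rw [Matrix.mul_sub, SO3.mul_transpose_cancel_left, Matrix.mul_one, Matrix.sub_mul,
      SO3.mul_transpose]
  rw [attNorm, attNorm, h]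

end

section

/-! ### Absolutely continuous functions with one-sided bounds on the derivative -/

theorem sub_le_of_ae_deriv_le {f : ℝ → ℝ} {a b C : ℝ} (hab : a ≤ b)
    (hf : AbsolutelyContinuousOnInterval f a b)
    (h : ∀ᵐ t : ℝ, t ∈ Set.Ioo a b → ∃ f', HasDerivAt f f' t ∧ f' ≤ C) :
    f b - f a ≤ C * (b - a) := by
  rw [← hf.integral_deriv_eq_sub]
  have h2 : ∫ _t in a..b, C = C * (b - a) := by
    rw [intervalIntegral.integral_const, smul_eq_mul, mul_comm]
  rw [← h2]
  refine intervalIntegral.integral_mono_ae_restrict hab hf.intervalIntegrable_deriv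
    intervalIntegrable_const ?_
  have hb : ∀ᵐ t : ℝ, t ≠ b := by simp [ae_iff]
  have ha : ∀ᵐ t : ℝ, t ≠ a := by simp [ae_iff]
  rw [EventuallyLE, ae_restrict_iff' measurableSet_Icc]
  filter_upwards [h, ha, hb] with t ht hta htb htm
  obtain ⟨f', hd, hle⟩ := ht ⟨lt_of_le_of_ne htm.1 hta.symm, lt_of_le_of_ne htm.2 htb⟩
  rwa [hd.deriv]

theorem abs_sub_le_of_ae_abs_deriv_le {f : ℝ → ℝ} {a b C : ℝ} (hab : a ≤ b)
    (hf : AbsolutelyContinuousOnInterval f a b)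
    (h : ∀ᵐ t : ℝ, t ∈ Set.Ioo a b → ∃ f', HasDerivAt f f' t ∧ |f'| ≤ C) :
    |f b - f a| ≤ C * (b - a) := by
  refine abs_sub_le_iff.2 ⟨sub_le_of_ae_deriv_le hab hf ?_, ?_⟩
  · filter_upwards [h] with t ht htm
    obtain ⟨f', hd, hle⟩ := ht htm
    exact ⟨f', hd, (abs_le.1 hle).2⟩
  · have := sub_le_of_ae_deriv_le (C := C) hab hf.fun_neg (by
      filter_upwards [h] with t ht htm
      obtain ⟨f', hd, hle⟩ := ht htm
      exact ⟨-f', hd.fun_neg, neg_le.1 (abs_le.1 hle).1⟩)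
    linarith

theorem le_exp_mul_of_ae_deriv_le {f : ℝ → ℝ} {a b c : ℝ} (hab : a ≤ b)
    (hf : AbsolutelyContinuousOnInterval f a b)
    (h : ∀ᵐ t : ℝ, t ∈ Set.Ioo a b → ∃ f', HasDerivAt f f' t ∧ f' ≤ -c * f t) :
    f b ≤ Real.exp (-c * (b - a)) * f a := by
  have hE : AbsolutelyContinuousOnInterval (fun t => Real.exp (c * (t - a))) a b :=
    ContDiffOn.absolutelyContinuousOnInterval (ContDiff.contDiffOn (by fun_prop))
  have := sub_le_of_ae_deriv_le (C := 0) hab (hE.fun_mul hf) (by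
    filter_upwards [h] with t ht htm
    obtain ⟨f', hd, hle⟩ := ht htm
    have h1 : HasDerivAt (fun t => Real.exp (c * (t - a))) (Real.exp (c * (t - a)) * (c * 1)) t :=
      (((hasDerivAt_id t).sub_const a).const_mul c).exp
    refine ⟨_, h1.fun_mul hd, ?_⟩
    have := mul_le_mul_of_nonneg_left hle (Real.exp_pos (c * (t - a))).le
    linarith)
  simp only [sub_self, mul_zero, Real.exp_zero, one_mul, zero_mul, sub_nonpos] at this
  have h3 := mul_le_mul_of_nonneg_left this (Real.exp_pos (-c * (b - a))).le
  rw [← mul_assoc, ← Real.exp_add] at h3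
  simpa using h3

theorem lipschitzOnWith_of_abs_sub_le {f : ℝ → ℝ} {S : Set ℝ} {C : ℝ}
    (h : ∀ x ∈ S, ∀ y ∈ S, x ≤ y → |f y - f x| ≤ C * (y - x)) :
    LipschitzOnWith C.toNNReal f S := by
  refine LipschitzOnWith.of_dist_le_mul fun x hx y hy => ?_
  have hC : C ≤ C.toNNReal := Real.le_coe_toNNReal C
  rcases le_total x y with hxy | hxy
  · rw [dist_comm, dist_comm x, Real.dist_eq, Real.dist_eq, abs_of_nonneg (sub_nonneg.2 hxy)]
    exact (h x hx y hy hxy).trans (mul_le_mul_of_nonneg_right hC (sub_nonneg.2 hxy))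
  · rw [Real.dist_eq, Real.dist_eq, abs_of_nonneg (sub_nonneg.2 hxy)]
    exact (h y hy x hx hxy).trans (mul_le_mul_of_nonneg_right hC (sub_nonneg.2 hxy))

theorem absolutelyContinuousOnInterval_of_abs_sub_le {f : ℝ → ℝ} {a b C : ℝ} (hab : a ≤ b)
    (h : ∀ x ∈ Set.Icc a b, ∀ y ∈ Set.Icc a b, x ≤ y → |f y - f x| ≤ C * (y - x)) :
    AbsolutelyContinuousOnInterval f a b := by
  rw [← Set.uIcc_of_le hab] at h
  exact (lipschitzOnWith_of_abs_sub_le h).absolutelyContinuousOnInterval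

theorem absolutelyContinuousOnInterval_sum {ι : Type*} {s : Finset ι} {f : ι → ℝ → ℝ} {a b : ℝ}
    (h : ∀ i ∈ s, AbsolutelyContinuousOnInterval (f i) a b) :
    AbsolutelyContinuousOnInterval (fun t => ∑ i ∈ s, f i t) a b := by
  classical
  induction s using Finset.induction_on with
  | empty =>
    simp only [Finset.sum_empty]
    exact ContDiffOn.absolutelyContinuousOnInterval contDiffOn_const
  | insert i s hi ih =>
    simp only [Finset.sum_insert hi]
    exact (h i (Finset.mem_insert_self i s)).fun_add
      (ih fun j hj => h j (Finset.mem_insert_of_mem hj))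

/-! ### Curves in `SO(3)` -/

theorem continuousOn_SO3_iff {γ : ℝ → SO3} {s : Set ℝ} :
    ContinuousOn γ s ↔ ∀ i j, ContinuousOn (fun t => (γ t : Mat3) i j) s := by
  rw [Topology.IsInducing.subtypeVal.continuousOn_iff]
  change ContinuousOn (fun t => ((γ t : Mat3) : Fin 3 → Fin 3 → ℝ)) s ↔ _
  exact continuousOn_pi.trans (forall_congr' fun i => continuousOn_pi)

theorem continuousAt_SO3_iff {γ : ℝ → SO3} {t : ℝ} :
    ContinuousAt γ t ↔ ∀ i j, ContinuousAt (fun t => (γ t : Mat3) i j) t := by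
  rw [Topology.IsInducing.subtypeVal.continuousAt_iff]
  change ContinuousAt (fun t => ((γ t : Mat3) : Fin 3 → Fin 3 → ℝ)) t ↔ _
  exact continuousAt_pi.trans (forall_congr' fun i => continuousAt_pi)

theorem continuousOn_SO3_of_frobNorm_sub_le {γ : ℝ → SO3} {a b L : ℝ}
    (h : ∀ x ∈ Set.Icc a b, ∀ y ∈ Set.Icc a b, x ≤ y →
      frobNorm ((γ y : Mat3) - (γ x : Mat3)) ≤ L * (y - x)) :
    ContinuousOn γ (Set.Icc a b) := by
  refine continuousOn_SO3_iff.2 fun i j => ?_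
  rcases lt_or_ge b a with hab | hab
  · rw [Set.Icc_eq_empty hab.not_ge]; exact continuousOn_empty _
  have := (absolutelyContinuousOnInterval_of_abs_sub_le (f := fun t => (γ t : Mat3) i j) (C := L)
    hab fun x hx y hy hxy =>
      (abs_entry_le_frobNorm ((γ y : Mat3) - (γ x : Mat3)) i j).trans (h x hx y hy hxy)).continuousOn
  rwa [Set.uIcc_of_le hab] at this

/-- Along a curve in `SO(3)`, a function that is differentiable at a point of the curve is bounded
to first order by the norm of its gradient times the speed of the curve. -/
theorem HasGradSO3.eventually_abs_sub_le {f : SO3 → ℝ} {G : Mat3} {γ : ℝ → SO3} {s : Set ℝ}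
    {t L M r : ℝ} (h : HasGradSO3 f G (γ t)) (hγ : ContinuousWithinAt γ s t) (hL : 0 ≤ L)
    (hγL : ∀ᶠ z in 𝓝[s] t, frobNorm ((γ z : Mat3) - (γ t : Mat3)) ≤ L * |z - t|)
    (hG : frobNorm G ≤ M) (hr : M * L < r) :
    ∀ᶠ z in 𝓝[s] t, |f (γ z) - f (γ t)| ≤ r * |z - t| := by
  obtain ⟨ε, hε, hεr⟩ : ∃ ε > 0, (M + ε) * L ≤ r := by
    refine ⟨(r - M * L) / (L + 1), by have := sub_pos.2 hr; positivity, ?_⟩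
    have h1 : (r - M * L) / (L + 1) * L ≤ r - M * L := by
      rw [div_mul_eq_mul_div, div_le_iff₀ (by positivity)]
      nlinarith
    linarith
  filter_upwards [hγ.eventually (h.2.def hε), hγL] with z hz hzL
  have h1 := (abs_frobInner_le G ((γ z : Mat3) - (γ t : Mat3)))
  rw [Real.norm_eq_abs, Real.norm_of_nonneg (frobNorm_nonneg _)] at hz
  have h2 : |f (γ z) - f (γ t)| ≤ (M + ε) * frobNorm ((γ z : Mat3) - (γ t : Mat3)) := by
    have h3 : |f (γ z) - f (γ t)| ≤
        |f (γ z) - f (γ t) - frobInner G ((γ z : Mat3) - (γ t : Mat3))| +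
          |frobInner G ((γ z : Mat3) - (γ t : Mat3))| := by
      simpa using abs_add_le (f (γ z) - f (γ t) - frobInner G ((γ z : Mat3) - (γ t : Mat3)))
        (frobInner G ((γ z : Mat3) - (γ t : Mat3)))
    have h4 := mul_le_mul_of_nonneg_right hG (frobNorm_nonneg ((γ z : Mat3) - (γ t : Mat3)))
    linarith
  have hM : 0 ≤ M := (frobNorm_nonneg G).trans hG
  calc _ ≤ _ := h2
    _ ≤ (M + ε) * (L * |z - t|) := mul_le_mul_of_nonneg_left hzL (by positivity)
    _ = ((M + ε) * L) * |z - t| := by ring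
    _ ≤ _ := mul_le_mul_of_nonneg_right hεr (abs_nonneg _)

theorem abs_sub_le_of_hasGradSO3 {f : SO3 → ℝ} {γ : ℝ → SO3} {a b L M : ℝ} (hL : 0 ≤ L)
    (hγ : ∀ x ∈ Set.Icc a b, ∀ y ∈ Set.Icc a b, x ≤ y →
      frobNorm ((γ y : Mat3) - (γ x : Mat3)) ≤ L * (y - x))
    (hf : Continuous f)
    (hG : ∀ t ∈ Set.Icc a b, ∃ G, HasGradSO3 f G (γ t) ∧ frobNorm G ≤ M) (hab : a ≤ b) :
    |f (γ b) - f (γ a)| ≤ M * L * (b - a) := by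
  have hcont : ContinuousOn γ (Set.Icc a b) := continuousOn_SO3_of_frobNorm_sub_le hγ
  have hfc : ContinuousOn (fun t => f (γ t)) (Set.Icc a b) := hf.comp_continuousOn hcont
  have key : ∀ x ∈ Set.Ico a b, ∀ r, M * L < r →
      ∀ᶠ z in 𝓝[>] x, |f (γ z) - f (γ x)| ≤ r * (z - x) := by
    intro x hx r hr
    obtain ⟨G, hG1, hG2⟩ := hG x (Set.Ico_subset_Icc_self hx)
    have hmem : Set.Icc a b ∈ 𝓝[>] x :=
      mem_of_superset (Ioo_mem_nhdsGT hx.2) fun z hz => ⟨hx.1.trans hz.1.le, hz.2.le⟩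
    have hle : ∀ᶠ z in 𝓝[>] x, x < z := self_mem_nhdsWithin
    have hc : ContinuousWithinAt γ (Set.Ioi x) x :=
      ((hcont x (Set.Ico_subset_Icc_self hx)).mono_of_mem_nhdsWithin hmem)
    have := hG1.eventually_abs_sub_le (s := Set.Ioi x) hc hL (by
      filter_upwards [hmem, hle] with z hz hxz
      rw [abs_of_pos (sub_pos.2 hxz)]
      exact hγ x (Set.Ico_subset_Icc_self hx) z hz hxz.le) hG2 hr
    filter_upwards [this, hle] with z hz hxz
    rwa [abs_of_pos (sub_pos.2 hxz)] at hz
  have gen : ∀ g : ℝ → ℝ, ContinuousOn g (Set.Icc a b) →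
      (∀ x ∈ Set.Ico a b, ∀ r, M * L < r → ∀ᶠ z in 𝓝[>] x, g z - g x ≤ r * (z - x)) →
      g b - g a ≤ M * L * (b - a) := by
    intro g hg hbound
    have := image_le_of_liminf_slope_right_le_deriv_boundary (f := g) (a := a) (b := b) hg
      (B := fun t => g a + M * L * (t - a)) (B' := fun _ => M * L) (by simp)
      (by fun_prop) (fun x _ => by
        simpa using ((((hasDerivAt_id x).sub_const a).const_mul (M * L)).const_add
          (g a)).hasDerivWithinAt)
      (fun x hx r hr => by
        obtain ⟨r', hr1, hr2⟩ := exists_between hr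
        refine Eventually.frequently ?_
        have hle : ∀ᶠ z in 𝓝[>] x, x < z := self_mem_nhdsWithin
        filter_upwards [hbound x hx r' hr1, hle] with z hz hxz
        rw [slope_def_field]
        exact lt_of_le_of_lt ((div_le_iff₀ (sub_pos.2 hxz)).2 hz) hr2)
      (Set.right_mem_Icc.2 hab)
    linarith
  refine abs_sub_le_iff.2 ⟨gen _ hfc fun x hx r hr => ?_, ?_⟩
  · filter_upwards [key x hx r hr] with z hz using (abs_le.1 hz).2
  · have := gen _ hfc.fun_neg fun x hx r hr => by
      filter_upwards [key x hx r hr] with z hz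
      linarith [(abs_le.1 hz).1]
    linarith

/-- The chain rule along a curve in `SO(3)`. -/
theorem HasGradSO3.hasDerivAt_comp {f : SO3 → ℝ} {G A : Mat3} {γ : ℝ → SO3} {t : ℝ}
    (h : HasGradSO3 f G (γ t)) (hγ : ∀ i j, HasDerivAt (fun s => (γ s : Mat3) i j) (A i j) t) :
    HasDerivAt (fun s => f (γ s)) (frobInner G A) t := by
  have hc : ContinuousAt γ t := continuousAt_SO3_iff.2 fun i j => (hγ i j).continuousAt
  have hlin : HasDerivAt (fun s => frobInner G ((γ s : Mat3) - (γ t : Mat3))) (frobInner G A) t := by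
    simp only [frobInner_eq_sum]
    exact HasDerivAt.fun_sum fun i _ => HasDerivAt.fun_sum fun j _ =>
      ((hγ i j).sub_const _).const_mul _
  have hO : (fun s => frobNorm ((γ s : Mat3) - (γ t : Mat3))) =O[𝓝 t] fun s => s - t := by
    have h1 : (fun s => ∑ i, ∑ j, ‖(γ s : Mat3) i j - (γ t : Mat3) i j‖) =O[𝓝 t]
        fun s => s - t :=
      IsBigO.fun_sum fun i _ => IsBigO.fun_sum fun j _ => (hγ i j).isBigO_sub.norm_left
    refine IsBigO.trans (IsBigO.of_bound 3 (Eventually.of_forall fun s => ?_)) h1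
    rw [Real.norm_of_nonneg (frobNorm_nonneg _), Real.norm_of_nonneg (by positivity)]
    refine frobNorm_le_of_entry_le fun i j => ?_
    refine (Finset.single_le_sum (f := fun j => ‖(γ s : Mat3) i j - (γ t : Mat3) i j‖)
      (fun j _ => norm_nonneg _) (Finset.mem_univ j)).trans ?_
    exact (Finset.single_le_sum (f := fun i => ∑ j, ‖(γ s : Mat3) i j - (γ t : Mat3) i j‖)
      (fun i _ => by positivity) (Finset.mem_univ i))
  rw [hasDerivAt_iff_isLittleO] at hlin ⊢
  have h2 := (h.2.comp_tendsto hc).trans_isBigO hO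
  refine (h2.add hlin).congr_left fun s => ?_
  have h0 : frobInner G ((γ t : Mat3) - (γ t : Mat3)) = 0 := by
    rw [sub_self, frobInner, Matrix.mul_zero, Matrix.trace_zero]
  simp only [Function.comp_apply, h0]
  ring

end

section

/-! ### Peano's existence theorem -/

section Peano

variable {E : Type*} [NormedAddCommGroup E] [NormedSpace ℝ E]

/-- Successive approximations of the delayed integral equation
`y t = x₀ + ∫ s in t₀..t, f s (y (s - h))`, frozen at `x₀` before time `t₀`. -/
noncomputable def delayedIterate (f : ℝ → E → E) (t₀ : ℝ) (x₀ : E) (h : ℝ) : ℕ → ℝ → E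
  | 0 => fun _ => x₀
  | k + 1 => fun t => x₀ + ∫ s in t₀..max t₀ t, f s (delayedIterate f t₀ x₀ h k (s - h))

variable {f : ℝ → E → E} {t₀ : ℝ} {x₀ : E} {h M : ℝ}

theorem delayedIterate_lipschitz (hf : Continuous (Function.uncurry f)) (hM : ∀ t x, ‖f t x‖ ≤ M)
    (k : ℕ) : LipschitzWith M.toNNReal (delayedIterate f t₀ x₀ h k) := by
  have hM0 : 0 ≤ M := (norm_nonneg _).trans (hM t₀ x₀)
  induction k with
  | zero => exact (LipschitzWith.const x₀).weaken bot_le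
  | succ k ih =>
    have hc : Continuous fun s => f s (delayedIterate f t₀ x₀ h k (s - h)) :=
      hf.comp (continuous_id.prodMk (ih.continuous.comp (continuous_id.sub continuous_const)))
    refine LipschitzWith.of_dist_le_mul fun a b => ?_
    simp only [delayedIterate, dist_add_left]
    rw [dist_eq_norm, intervalIntegral.integral_interval_sub_left (hc.intervalIntegrable _ _)
      (hc.intervalIntegrable _ _), Real.coe_toNNReal M hM0]
    refine (intervalIntegral.norm_integral_le_of_norm_le_const fun x _ => hM _ _).trans ?_
    refine mul_le_mul_of_nonneg_left ?_ hM0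
    simpa [max_comm, Real.dist_eq] using abs_max_sub_max_le_abs a b t₀

/-- Each further iteration fixes the solution of the delayed equation on one more interval of
length `h`. -/
theorem delayedIterate_succ_eq (hh : 0 ≤ h) (k : ℕ) {t : ℝ} (ht : t ≤ t₀ + k * h) :
    delayedIterate f t₀ x₀ h (k + 1) t = delayedIterate f t₀ x₀ h k t := by
  induction k generalizing t with
  | zero =>
    have : max t₀ t = t₀ := max_eq_left (by simpa using ht)
    simp [delayedIterate, this]
  | succ k ih =>
    change x₀ + _ = x₀ + _
    congr 1
    refine intervalIntegral.integral_congr fun s hs => ?_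
    rw [Set.uIcc_of_le (le_max_left _ _)] at hs
    have hs2 : s ≤ t₀ + (k + 1 : ℕ) * h := hs.2.trans (max_le (by
      have : 0 ≤ ((k + 1 : ℕ) : ℝ) * h := by positivity
      linarith) ht)
    rw [ih]
    push_cast at hs2
    linarith

/-- Existence on a unit time interval for a bounded continuous right-hand side: solutions of the
equations with delay `1 / (n + 1)` are equi-Lipschitz, and a limit point solves the equation
without delay. -/
theorem exists_solution_of_bounded [ProperSpace E] (hf : Continuous (Function.uncurry f))
    (hM : ∀ t x, ‖f t x‖ ≤ M) (t₀ : ℝ) (x₀ : E) :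
    ∃ x : ℝ → E, x t₀ = x₀ ∧ LipschitzWith M.toNNReal x ∧
      ∀ t ∈ Set.Ioo t₀ (t₀ + 1), HasDerivAt x (f t (x t)) t := by
  have hM0 : 0 ≤ M := (norm_nonneg _).trans (hM t₀ x₀)
  set d : ℕ → ℝ := fun n => 1 / (n + 1 : ℝ) with hd
  have hd0 : ∀ n, 0 < d n := fun n => by positivity
  set z : ℕ → ℝ → E := fun n => delayedIterate f t₀ x₀ (d n) (n + 1) with hz
  have zlip : ∀ n, LipschitzWith M.toNNReal (z n) := fun n => delayedIterate_lipschitz hf hM _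
  have zeq : ∀ n, ∀ t ∈ Set.Icc t₀ (t₀ + 1),
      z n t = x₀ + ∫ s in t₀..t, f s (z n (s - d n)) := by
    intro n t ht
    have h1 := delayedIterate_succ_eq (f := f) (x₀ := x₀) (hd0 n).le (n + 1) (t := t) (by
      refine ht.2.trans (le_of_eq ?_)
      simp only [hd]; push_cast; field_simp)
    rw [hz]
    simp only
    rw [← h1]
    change x₀ + _ = _
    rw [max_eq_right ht.1]
  have zt0 : ∀ n, z n t₀ = x₀ := fun n => by
    rw [zeq n t₀ ⟨le_rfl, by linarith⟩]; simp
  have : Fact (t₀ ≤ t₀ + 1) := ⟨by linarith⟩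
  let g : ℕ → BoundedContinuousFunction (Set.Icc t₀ (t₀ + 1)) E := fun n =>
    BoundedContinuousFunction.mkOfCompact ⟨fun t => z n t, (zlip n).continuous.comp continuous_subtype_val⟩
  have hcomp : IsCompact (closure (Set.range g)) := by
    refine BoundedContinuousFunction.arzela_ascoli (Metric.closedBall x₀ M)
      (isCompact_closedBall _ _) _ ?_ ?_
    · rintro _ t ⟨n, rfl⟩
      change dist (z n t) x₀ ≤ M
      rw [← zt0 n]
      refine ((zlip n).dist_le_mul t t₀).trans ?_
      rw [Real.coe_toNNReal M hM0, Real.dist_eq]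
      have h1 : |(t : ℝ) - t₀| ≤ 1 := by
        rw [abs_of_nonneg (sub_nonneg.2 t.2.1)]; linarith [t.2.2]
      exact mul_le_of_le_one_right hM0 h1
    · refine (LipschitzWith.uniformEquicontinuous _ M.toNNReal ?_).equicontinuous
      rintro ⟨_, n, rfl⟩
      exact LipschitzWith.of_dist_le_mul fun a b => (zlip n).dist_le_mul a b
  obtain ⟨G, -, φ, hφ, hlim⟩ := hcomp.tendsto_subseq (x := g) fun n => subset_closure ⟨n, rfl⟩
  have hpt : ∀ t : Set.Icc t₀ (t₀ + 1), Tendsto (fun n => z (φ n) t) atTop (𝓝 (G t)) := fun t =>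
    ((BoundedContinuousFunction.tendsto_iff_tendstoUniformly.1 hlim).tendsto_at t)
  have Glip : LipschitzWith M.toNNReal G := LipschitzWith.of_dist_le_mul fun a b =>
    le_of_tendsto ((hpt a).dist (hpt b)) (Eventually.of_forall fun n => (zlip _).dist_le_mul a b)
  set x : ℝ → E := Set.IccExtend this.out G with hx
  have hxG : ∀ t (ht : t ∈ Set.Icc t₀ (t₀ + 1)), x t = G ⟨t, ht⟩ := fun t ht =>
    Set.IccExtend_of_mem _ _ ht
  have xlip : LipschitzWith M.toNNReal x := by
    simpa using! Glip.comp (LipschitzWith.projIcc this.out)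
  have hxt0 : x t₀ = x₀ := by
    rw [hxG t₀ ⟨le_rfl, by linarith⟩]
    exact tendsto_nhds_unique (hpt _) (by simp only [zt0]; exact tendsto_const_nhds)
  have hcf : Continuous fun s => f s (x s) := hf.comp (continuous_id.prodMk xlip.continuous)
  have xeq : ∀ t ∈ Set.Icc t₀ (t₀ + 1), x t = x₀ + ∫ s in t₀..t, f s (x s) := by
    intro t ht
    rw [hxG t ht]
    refine tendsto_nhds_unique (hpt ⟨t, ht⟩) ?_
    simp only [zeq _ t ht]
    refine tendsto_const_nhds.add ?_
    refine intervalIntegral.tendsto_integral_filter_of_dominated_convergence (fun _ => M) ?_ ?_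
      intervalIntegrable_const ?_
    · refine Eventually.of_forall fun n => Continuous.aestronglyMeasurable ?_
      exact hf.comp (continuous_id.prodMk
        ((zlip _).continuous.comp (continuous_id.sub continuous_const)))
    · exact Eventually.of_forall fun n => Eventually.of_forall fun s _ => hM _ _
    · refine Eventually.of_forall fun s hs => ?_
      rw [Set.uIoc_of_le ht.1] at hs
      have hs' : s ∈ Set.Icc t₀ (t₀ + 1) := ⟨hs.1.le, hs.2.trans ht.2⟩
      have h1 : Tendsto (fun n => z (φ n) (s - d (φ n))) atTop (𝓝 (x s)) := by
        rw [hxG s hs']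
        refine tendsto_of_tendsto_of_dist (hpt ⟨s, hs'⟩) ?_
        have h2 : Tendsto (fun n => M * d (φ n)) atTop (𝓝 0) := by
          have := (tendsto_one_div_add_atTop_nhds_zero_nat (𝕜 := ℝ)).comp hφ.tendsto_atTop
          simpa [hd] using this.const_mul M
        refine squeeze_zero (fun _ => dist_nonneg) (fun n => ?_) h2
        refine ((zlip (φ n)).dist_le_mul _ _).trans (le_of_eq ?_)
        rw [Real.coe_toNNReal M hM0, Real.dist_eq]
        simp [abs_of_pos (hd0 (φ n))]
      exact ((hf.comp (continuous_const.prodMk continuous_id)).tendsto (x s)).comp h1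
  refine ⟨x, hxt0, xlip, fun t ht => ?_⟩
  have hder : HasDerivAt (fun t => x₀ + ∫ s in t₀..t, f s (x s)) (f t (x t)) t :=
    (intervalIntegral.integral_hasDerivAt_right (hcf.intervalIntegrable _ _)
      (hcf.stronglyMeasurableAtFilter _ _) hcf.continuousAt).const_add x₀
  refine hder.congr_of_eventuallyEq ?_
  filter_upwards [Ioo_mem_nhds ht.1 ht.2] with s hs
  exact xeq s (Set.Ioo_subset_Icc_self hs)

/-- **Peano's existence theorem**: local existence for a continuous right-hand side. -/
theorem exists_local_solution [ProperSpace E] (hf : Continuous (Function.uncurry f))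
    (t₀ : ℝ) (x₀ : E) :
    ∃ ε > 0, ∃ K, ∃ x : ℝ → E, x t₀ = x₀ ∧ LipschitzWith K x ∧
      ∀ t ∈ Set.Ioo t₀ (t₀ + ε), HasDerivAt x (f t (x t)) t := by
  -- Cut the right-hand side off outside a ball of radius two.
  set ρ : ℝ × E → ℝ := fun p => max 0 (min 1 (2 - dist p (t₀, x₀))) with hρ
  have ρc : Continuous ρ := by fun_prop
  obtain ⟨C, hC⟩ := (isCompact_closedBall (t₀, x₀) (2 : ℝ)).exists_bound_of_continuousOn
    hf.continuousOn
  have hC0 : 0 ≤ C := (norm_nonneg _).trans (hC (t₀, x₀) (by simp))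
  obtain ⟨x, hx0, hxl, hxd⟩ := exists_solution_of_bounded (f := fun t x => ρ (t, x) • f t x)
    (M := C) (ρc.smul hf) (fun t y => by
      rw [norm_smul, Real.norm_of_nonneg (le_max_left _ _)]
      rcases le_total (dist (t, y) (t₀, x₀)) 2 with h2 | h2
      · have h3 : ρ (t, y) ≤ 1 := max_le zero_le_one (min_le_left _ _)
        exact (mul_le_mul h3 (hC (t, y) h2) (norm_nonneg _) zero_le_one).trans_eq (one_mul C)
      · have : ρ (t, y) = 0 := max_eq_left ((min_le_right _ _).trans (sub_nonpos.2 h2))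
        exact (mul_eq_zero_of_left this _).trans_le hC0) t₀ x₀
  have hev : ∀ᶠ t in 𝓝 t₀, dist (t, x t) (t₀, x₀) < 1 := by
    have hc : Continuous fun t => dist (t, x t) (t₀, x₀) :=
      (continuous_id.prodMk hxl.continuous).dist continuous_const
    exact hc.continuousAt.eventually_lt_const (by simp [hx0])
  obtain ⟨ε, hε, hball⟩ := Metric.eventually_nhds_iff.1 hev
  refine ⟨min ε 1, lt_min hε one_pos, _, x, hx0, hxl, fun t ht => ?_⟩
  have h1 := hxd t ⟨ht.1, ht.2.trans_le (add_le_add_right (min_le_right ε 1) t₀)⟩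
  have h2 := hball (y := t) (by
    rw [Real.dist_eq, abs_of_pos (sub_pos.2 ht.1)]
    linarith [ht.2, min_le_left ε 1])
  have h3 : ρ (t, x t) = 1 := by
    simp only [hρ]
    rw [min_eq_left (by linarith), max_eq_right zero_le_one]
  simpa [h3] using h1

end Peano

end

section

variable {Q : Type*}

/-! ### Calculus of matrix-valued curves, entry by entry -/

section Entries

variable {A B : ℝ → Mat3} {A' B' : Mat3} {t a b : ℝ}

theorem hasDerivAt_mul_entry (hA : ∀ i j, HasDerivAt (fun s => A s i j) (A' i j) t)
    (hB : ∀ i j, HasDerivAt (fun s => B s i j) (B' i j) t) (i j : Fin 3) :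
    HasDerivAt (fun s => (A s * B s) i j) ((A' * B t + A t * B') i j) t := by
  simp only [Matrix.mul_apply, Matrix.add_apply, ← Finset.sum_add_distrib]
  exact HasDerivAt.fun_sum fun k _ => (hA i k).fun_mul (hB k j)

theorem hasDerivAt_frobInner (hA : ∀ i j, HasDerivAt (fun s => A s i j) (A' i j) t)
    (hB : ∀ i j, HasDerivAt (fun s => B s i j) (B' i j) t) :
    HasDerivAt (fun s => frobInner (A s) (B s)) (frobInner A' (B t) + frobInner (A t) B') t := by
  simp only [frobInner_eq_sum, ← Finset.sum_add_distrib]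
  exact HasDerivAt.fun_sum fun i _ => HasDerivAt.fun_sum fun j _ => (hA i j).fun_mul (hB i j)

theorem absolutelyContinuousOnInterval_mul_entry
    (hA : ∀ i j, AbsolutelyContinuousOnInterval (fun s => A s i j) a b)
    (hB : ∀ i j, AbsolutelyContinuousOnInterval (fun s => B s i j) a b) (i j : Fin 3) :
    AbsolutelyContinuousOnInterval (fun s => (A s * B s) i j) a b := by
  simp only [Matrix.mul_apply]
  exact absolutelyContinuousOnInterval_sum fun k _ => (hA i k).fun_mul (hB k j)

theorem absolutelyContinuousOnInterval_frobInner
    (hA : ∀ i j, AbsolutelyContinuousOnInterval (fun s => A s i j) a b)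
    (hB : ∀ i j, AbsolutelyContinuousOnInterval (fun s => B s i j) a b) :
    AbsolutelyContinuousOnInterval (fun s => frobInner (A s) (B s)) a b := by
  simp only [frobInner_eq_sum]
  exact absolutelyContinuousOnInterval_sum fun i _ =>
    absolutelyContinuousOnInterval_sum fun j _ => (hA i j).fun_mul (hB i j)

theorem absolutelyContinuousOnInterval_const (c : ℝ) :
    AbsolutelyContinuousOnInterval (fun _ => c) a b :=
  ContDiffOn.absolutelyContinuousOnInterval contDiffOn_const

variable {v : ℝ → Fin 3 → ℝ} {v' : Fin 3 → ℝ}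

theorem hasDerivAt_hat_entry (hv : ∀ i, HasDerivAt (fun s => v s i) (v' i) t) (i j : Fin 3) :
    HasDerivAt (fun s => hat (v s) i j) (hat v' i j) t := by
  fin_cases i <;> fin_cases j <;>
    simp [hat, hv, (hv _).fun_neg, hasDerivAt_const]

theorem absolutelyContinuousOnInterval_hat_entry
    (hv : ∀ i, AbsolutelyContinuousOnInterval (fun s => v s i) a b) (i j : Fin 3) :
    AbsolutelyContinuousOnInterval (fun s => hat (v s) i j) a b := by
  fin_cases i <;> fin_cases j <;>
    simp [hat, hv, (hv _).fun_neg, absolutelyContinuousOnInterval_const]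

end Entries

/-! ### Flow and jump sets -/

section Sets

variable [Finite Q] {Φ : SO3 → Q → ℝ} {δ : ℝ} {X : SO3} {q : Q}

theorem mem_flowSet_iff : (X, q) ∈ flowSet Φ δ ↔ ∀ p, Φ X q - Φ X p ≤ δ := by
  have : Nonempty Q := ⟨q⟩
  change Φ X q - (⨅ p, Φ X p) ≤ δ ↔ _
  rw [sub_le_comm, le_ciInf_iff (Set.finite_range _).bddBelow]
  exact forall_congr' fun p => sub_le_comm

theorem notMem_jumpSet_iff : (X, q) ∉ jumpSet Φ δ ↔ ∀ p, Φ X q - Φ X p < δ := by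
  have : Nonempty Q := ⟨q⟩
  change ¬ δ ≤ Φ X q - (⨅ p, Φ X p) ↔ _
  rw [not_le]
  constructor
  · exact fun h p => lt_of_le_of_lt (sub_le_sub_left (ciInf_le (Set.finite_range _).bddBelow p) _) h
  · intro h
    obtain ⟨p, hp⟩ := exists_eq_ciInf_of_finite (f := fun p => Φ X p)
    rw [← hp]
    exact h p

theorem isClosed_flowSet_section (hΦ : ∀ q, Continuous fun X => Φ X q) (q : Q) :
    IsClosed {X | (X, q) ∈ flowSet Φ δ} := by
  simp only [mem_flowSet_iff, Set.ofPred_forall]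
  exact isClosed_iInter fun p => isClosed_le ((hΦ q).sub (hΦ p)) continuous_const

theorem isOpen_compl_jumpSet_section (hΦ : ∀ q, Continuous fun X => Φ X q) (q : Q) :
    IsOpen {X | (X, q) ∉ jumpSet Φ δ} := by
  simp only [notMem_jumpSet_iff, Set.ofPred_forall]
  exact isOpen_iInter_of_finite fun p => isOpen_lt ((hΦ q).sub (hΦ p)) continuous_const

theorem compl_jumpSet_subset_flowSet (h : (X, q) ∉ jumpSet Φ δ) : (X, q) ∈ flowSet Φ δ :=
  mem_flowSet_iff.2 fun p => (notMem_jumpSet_iff.1 h p).le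

end Sets

theorem add_le_of_mem_jumpSet {Φ : SO3 → Q → ℝ} {δ : ℝ} {X : SO3} {q : Q}
    (h : (X, q) ∈ jumpSet Φ δ) {p : Q} (hp : ∀ p', Φ X p ≤ Φ X p') :
    Φ X p + δ ≤ Φ X q := by
  have : Nonempty Q := ⟨q⟩
  have h1 : Φ X p ≤ ⨅ p, Φ X p := le_ciInf hp
  have h2 : δ ≤ Φ X q - ⨅ p, Φ X p := h
  linarith

/-! ### Hybrid time domains -/

namespace IsHybridTimeDomain

variable {t₀ t : ℝ} {E : Set (ℝ × ℕ)} {j : ℕ}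

theorem last_interval {τ : ℕ → ℝ} (hτ : Monotone τ) {J : ℕ} {I : Set ℝ}
    (hI : I = Set.Icc (τ J) (τ (J + 1)) ∨ (τ J < τ (J + 1) ∧ I = Set.Ico (τ J) (τ (J + 1))) ∨
          I = Set.Ici (τ J)) : τ J ∈ I ∧ I ⊆ Set.Ici (τ J) ∧ I.OrdConnected := by
  rcases hI with rfl | ⟨h, rfl⟩ | rfl
  · exact ⟨⟨le_rfl, hτ J.le_succ⟩, fun t ht => ht.1, Set.ordConnected_Icc⟩
  · exact ⟨⟨le_rfl, h⟩, fun t ht => ht.1, Set.ordConnected_Ico⟩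
  · exact ⟨Set.self_mem_Ici, le_rfl, Set.ordConnected_Ici⟩

theorem mem_of_mem_Icc (h : IsHybridTimeDomain t₀ E) {a b : ℝ} (ha : (a, j) ∈ E) (hb : (b, j) ∈ E)
    (ht : t ∈ Set.Icc a b) : (t, j) ∈ E := by
  obtain ⟨τ, hτ, -, rfl | ⟨J, I, hI, rfl⟩⟩ := h
  · exact ⟨ha.1.trans ht.1, ht.2.trans hb.2⟩
  · rcases ha with ⟨hj, ha⟩ | ⟨hj, ha⟩ <;> rcases hb with ⟨hj', hb⟩ | ⟨hj', hb⟩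
    · exact Or.inl ⟨hj, ha.1.trans ht.1, ht.2.trans hb.2⟩
    · exact absurd hj' hj.ne
    · exact absurd hj hj'.ne
    · exact Or.inr ⟨hj, (last_interval hτ hI).2.2.out ha hb ht⟩

theorem le_of_mem (h : IsHybridTimeDomain t₀ E) (ht : (t, j) ∈ E) : t₀ ≤ t := by
  obtain ⟨τ, hτ, rfl, rfl | ⟨J, I, hI, rfl⟩⟩ := h
  · exact (hτ (Nat.zero_le j)).trans ht.1
  · rcases ht with ⟨-, ht⟩ | ⟨hj, ht⟩
    · exact (hτ (Nat.zero_le j)).trans ht.1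
    · exact (hτ (Nat.zero_le J)).trans ((last_interval hτ hI).2.1 ht)

theorem initial_mem (h : IsHybridTimeDomain t₀ E) : (t₀, 0) ∈ E := by
  obtain ⟨τ, hτ, rfl, rfl | ⟨J, I, hI, rfl⟩⟩ := h
  · exact ⟨le_rfl, hτ (Nat.zero_le 1)⟩
  · rcases Nat.eq_zero_or_pos J with rfl | hJ
    · exact Or.inr ⟨rfl, (last_interval hτ hI).1⟩
    · exact Or.inl ⟨hJ, le_rfl, hτ (Nat.zero_le 1)⟩

/-- Each slice is entered through a jump from the previous one. -/
theorem exists_jump_le (h : IsHybridTimeDomain t₀ E) (ht : (t, j + 1) ∈ E) :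
    ∃ s ≤ t, (s, j) ∈ E ∧ (s, j + 1) ∈ E := by
  obtain ⟨τ, hτ, -, rfl | ⟨J, I, hI, rfl⟩⟩ := h
  · exact ⟨τ (j + 1), ht.1, ⟨hτ j.le_succ, le_rfl⟩, ⟨le_rfl, hτ (j + 1).le_succ⟩⟩
  · rcases ht with ⟨hj, ht⟩ | ⟨hj, ht⟩
    · exact ⟨τ (j + 1), ht.1, Or.inl ⟨j.lt_succ_self.trans hj, hτ j.le_succ, le_rfl⟩,
        Or.inl ⟨hj, le_rfl, hτ (j + 1).le_succ⟩⟩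
    · dsimp only at hj
      subst hj
      obtain ⟨h1, h2, -⟩ := last_interval hτ hI
      exact ⟨τ (j + 1), h2 ht, Or.inl ⟨j.lt_succ_self, hτ j.le_succ, le_rfl⟩, Or.inr ⟨rfl, h1⟩⟩

end IsHybridTimeDomain

/-! ### Standing assumptions -/

/-- The hypotheses of the stability theorem on the design of the observer. -/
structure Admissible (P : Design Q) (D : Set (SO3 × Q)) (α₁ α₂ α₃ α₄ : ℝ) : Prop where
  γP_pos : 0 < P.γP
  γI_pos : 0 < P.γI
  δ_pos : 0 < P.δ
  potential : IsPotential D P.Φ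
  flow_subset : flowSet P.Φ P.δ ⊆ D
  α₁_pos : 0 < α₁
  α₂_pos : 0 < α₂
  α₃_pos : 0 < α₃
  α₄_pos : 0 < α₄
  quad : ∀ X q, α₁ * attNorm X ^ 2 ≤ P.Φ X q ∧ P.Φ X q ≤ α₂ * attNorm X ^ 2
  grad : ∀ X q, (X, q) ∈ flowSet P.Φ P.δ →
      α₃ * attNorm X ^ 2 ≤ frobNorm (gradSO3 (fun Y => P.Φ Y q) X) ^ 2 ∧
      frobNorm (gradSO3 (fun Y => P.Φ Y q) X) ^ 2 ≤ α₄ * attNorm X ^ 2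

/-- A solution of the observer together with an attitude trajectory whose angular velocity is
bounded by `c`. -/
structure IsRun (P : Design Q) (c t₀ : ℝ) (ω : ℝ → Fin 3 → ℝ) (b : Fin 3 → ℝ) (R : ℝ → SO3)
    (x : Arc Q) : Prop where
  ω_le : ∀ t, 0 ≤ t → euclNorm (ω t) ≤ c
  t₀_nonneg : 0 ≤ t₀
  attitude : IsAttitude t₀ ω R
  solution : IsSolution P t₀ ω b R x

variable {P : Design Q} {D : Set (SO3 × Q)} {α₁ α₂ α₃ α₄ c t₀ : ℝ} {ω : ℝ → Fin 3 → ℝ}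
  {b : Fin 3 → ℝ} {R : ℝ → SO3} {x : Arc Q}

theorem Admissible.diffAt (hP : Admissible P D α₁ α₂ α₃ α₄) {X : SO3} {q : Q}
    (h : (X, q) ∈ flowSet P.Φ P.δ) : DiffAtSO3 (fun Y => P.Φ Y q) X :=
  hP.potential.diff X q (hP.flow_subset h)

theorem Admissible.innovation_sq (hP : Admissible P D α₁ α₂ α₃ α₄) {X Xh : SO3} {q : Q}
    (h : (X * Xh⁻¹, q) ∈ flowSet P.Φ P.δ) :
    α₃ / 2 * attNorm (X * Xh⁻¹) ^ 2 ≤ euclNorm (innovation P.Φ (X * Xh⁻¹) Xh q) ^ 2 ∧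
      euclNorm (innovation P.Φ (X * Xh⁻¹) Xh q) ≤ Real.sqrt (α₄ / 2) * attNorm (X * Xh⁻¹) := by
  have h1 := hP.grad _ _ h
  rw [frobNorm_gradSO3_sq (hP.diffAt h)] at h1
  refine ⟨by linarith [h1.1], ?_⟩
  refine le_of_sq_le_sq ?_ (mul_nonneg (Real.sqrt_nonneg _) (attNorm_nonneg _))
  rw [mul_pow, Real.sq_sqrt (by linarith [hP.α₄_pos])]
  linarith [h1.2]

theorem Admissible.innovation_le (hP : Admissible P D α₁ α₂ α₃ α₄) {X Xh : SO3} {q : Q}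
    (h : (X * Xh⁻¹, q) ∈ flowSet P.Φ P.δ) :
    euclNorm (innovation P.Φ (X * Xh⁻¹) Xh q) ≤ Real.sqrt (α₄ / 2) * 2 :=
  (hP.innovation_sq h).2.trans
    (mul_le_mul_of_nonneg_left (attNorm_le_two _) (Real.sqrt_nonneg _))

theorem IsRun.c_nonneg (h : IsRun P c t₀ ω b R x) : 0 ≤ c :=
  (euclNorm_nonneg _).trans (h.ω_le 0 le_rfl)

/-- The attitude trajectory is Lipschitz, because the angular velocity is bounded. -/
theorem IsRun.attitude_lipschitz (h : IsRun P c t₀ ω b R x) {s t : ℝ} (hs : t₀ ≤ s) (hst : s ≤ t) :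
    frobNorm ((R t : Mat3) - (R s : Mat3)) ≤ 3 * (Real.sqrt 2 * c) * (t - s) := by
  rw [mul_assoc]
  refine frobNorm_le_of_entry_le fun i k => ?_
  refine abs_sub_le_of_ae_abs_deriv_le (f := fun t => (R t : Mat3) i k) hst
    (h.attitude.ac (i, k) s hs t (hs.trans hst)) ?_
  filter_upwards [h.attitude.deriv] with r hr hrm
  refine ⟨_, hr (hs.trans_lt hrm.1) i k, (abs_entry_le_frobNorm _ i k).trans ?_⟩
  rw [SO3.frobNorm_mul_left, frobNorm_hat]
  exact mul_le_mul_of_nonneg_left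
    (h.ω_le r (h.t₀_nonneg.trans (hs.trans hrm.1.le))) (Real.sqrt_nonneg _)

theorem IsRun.attitude_continuousOn (h : IsRun P c t₀ ω b R x) :
    ContinuousOn R (Set.Ici t₀) := by
  intro t ht
  have h1 : ContinuousOn R (Set.Icc t₀ (t + 1)) :=
    continuousOn_SO3_of_frobNorm_sub_le fun s hs r _ hsr => h.attitude_lipschitz hs.1 hsr
  have ht' : t₀ ≤ t := ht
  refine (h1 t ⟨ht, by linarith⟩).mono_of_mem_nhdsWithin ?_
  rw [mem_nhdsWithin_iff_exists_mem_nhds_inter]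
  exact ⟨Set.Iio (t + 1), Iio_mem_nhds (by linarith), fun s hs => ⟨hs.2, hs.1.le⟩⟩

end

section

variable {Q : Type*} {P : Design Q} {D : Set (SO3 × Q)} {α₁ α₂ α₃ α₄ c t₀ : ℝ}
  {ω : ℝ → Fin 3 → ℝ} {b : Fin 3 → ℝ} {R : ℝ → SO3} {x : Arc Q} {j : ℕ} {s t B : ℝ}

/-! ### Regularity of solutions along flows -/

theorem Ioo_subset_interior_slice (h : IsHybridTimeDomain t₀ x.dom) (hs : s ∈ x.slice j)
    (ht : t ∈ x.slice j) : Set.Ioo s t ⊆ interior (x.slice j) :=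
  isOpen_Ioo.subset_interior_iff.2 fun _ hr =>
    h.mem_of_mem_Icc hs ht (Set.Ioo_subset_Icc_self hr)

theorem Icc_subset_slice (h : IsHybridTimeDomain t₀ x.dom) (hs : s ∈ x.slice j)
    (ht : t ∈ x.slice j) : Set.Icc s t ⊆ x.slice j :=
  fun _ hr => h.mem_of_mem_Icc hs ht hr

theorem coe_Rt (x : Arc Q) (R : ℝ → SO3) (t : ℝ) (j : ℕ) :
    ((x.Rt R t j : SO3) : Mat3) = (R t : Mat3) * (x.Rh t j : Mat3)ᵀ := rfl

namespace IsRun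

theorem attitude_ac (h : IsRun P c t₀ ω b R x) (hs : s ∈ x.slice j) (ht : t ∈ x.slice j)
    (i k : Fin 3) : AbsolutelyContinuousOnInterval (fun r => (R r : Mat3) i k) s t :=
  h.attitude.ac (i, k) s (h.solution.dom.le_of_mem hs) t (h.solution.dom.le_of_mem ht)

theorem estimate_ac (h : IsRun P c t₀ ω b R x) (hs : s ∈ x.slice j) (ht : t ∈ x.slice j)
    (i k : Fin 3) : AbsolutelyContinuousOnInterval (fun r => (x.Rh r j : Mat3) i k) s t :=
  h.solution.ac_Rh j (i, k) s hs t ht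

theorem bias_error_ac (h : IsRun P c t₀ ω b R x) (hs : s ∈ x.slice j) (ht : t ∈ x.slice j)
    (i : Fin 3) : AbsolutelyContinuousOnInterval (fun r => (b - x.bh r j) i) s t :=
  (absolutelyContinuousOnInterval_const (b i)).fun_sub (h.solution.ac_bh j i s hs t ht)

theorem Rt_continuousOn (h : IsRun P c t₀ ω b R x) (hs : s ∈ x.slice j) (ht : t ∈ x.slice j)
    (hst : s ≤ t) : ContinuousOn (fun r => x.Rt R r j) (Set.Icc s t) := by
  refine continuousOn_SO3_iff.2 fun i k => ?_
  rw [← Set.uIcc_of_le hst]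
  exact (absolutelyContinuousOnInterval_mul_entry (h.attitude_ac hs ht)
    (B := fun r => (x.Rh r j : Mat3)ᵀ) (fun i k => h.estimate_ac hs ht k i) i k).continuousOn

/-- On a nondegenerate flow interval the error stays in the flow set, endpoints included. -/
theorem flow_mem_Icc [Finite Q] (hΦ : ∀ q, Continuous fun X => P.Φ X q)
    (h : IsRun P c t₀ ω b R x) (hs : s ∈ x.slice j) (ht : t ∈ x.slice j)
    (hst : s < t) {r : ℝ} (hr : r ∈ Set.Icc s t) :
    (x.Rt R r j, x.q s j) ∈ flowSet P.Φ P.δ := by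
  have hcl : IsClosed (Set.Icc s t ∩
      (fun r => x.Rt R r j) ⁻¹' {X | (X, x.q s j) ∈ flowSet P.Φ P.δ}) :=
    (h.Rt_continuousOn hs ht hst.le).preimage_isClosed_of_isClosed isClosed_Icc
      (isClosed_flowSet_section hΦ _)
  have hsub : Set.Ioo s t ⊆ Set.Icc s t ∩
      (fun r => x.Rt R r j) ⁻¹' {X | (X, x.q s j) ∈ flowSet P.Φ P.δ} := fun r hr => by
    refine ⟨Set.Ioo_subset_Icc_self hr, ?_⟩
    have hint := Ioo_subset_interior_slice h.solution.dom hs ht hr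
    have := h.solution.flow_mem j r hint
    rwa [h.solution.flow_q j r (interior_subset hint) s hs] at this
  have := closure_minimal hsub hcl
  rw [closure_Ioo hst.ne] at this
  exact (this hr).2

section Flow

variable (hP : Admissible P D α₁ α₂ α₃ α₄) (h : IsRun P c t₀ ω b R x)
include hP h

theorem innovation_flow_le {r : ℝ} (hr : r ∈ interior (x.slice j)) :
    euclNorm (innovation P.Φ (x.Rt R r j) (x.Rh r j) (x.q r j)) ≤ Real.sqrt (α₄ / 2) * 2 :=
  hP.innovation_le (h.solution.flow_mem j r hr)

theorem bias_lipschitz (hs : s ∈ x.slice j) (ht : t ∈ x.slice j) (hst : s ≤ t) (i : Fin 3) :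
    |x.bh t j i - x.bh s j i| ≤ P.γI * (Real.sqrt (α₄ / 2) * 2) * (t - s) := by
  refine abs_sub_le_of_ae_abs_deriv_le (f := fun r => x.bh r j i) hst
    (h.solution.ac_bh j i s hs t ht) ?_
  filter_upwards [h.solution.flow_bh j] with r hr hrm
  have hint := Ioo_subset_interior_slice h.solution.dom hs ht hrm
  refine ⟨_, hr hint i, ?_⟩
  rw [Pi.neg_apply, abs_neg, Pi.smul_apply, smul_eq_mul, abs_mul, abs_of_pos hP.γI_pos]
  exact mul_le_mul_of_nonneg_left
    ((abs_coord_le_euclNorm _ i).trans (h.innovation_flow_le hP hint)) hP.γI_pos.le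

/-- As long as the bias error is bounded, so is the velocity of the attitude estimate. -/
theorem estimate_lipschitz (hs : s ∈ x.slice j) (ht : t ∈ x.slice j) (hst : s ≤ t)
    (hB : ∀ r ∈ Set.Icc s t, euclNorm (b - x.bh r j) ≤ B) :
    frobNorm ((x.Rh t j : Mat3) - (x.Rh s j : Mat3)) ≤
      3 * (Real.sqrt 2 * (c + B + P.γP * (Real.sqrt (α₄ / 2) * 2))) * (t - s) := by
  rw [mul_assoc]
  refine frobNorm_le_of_entry_le fun i k => ?_
  refine abs_sub_le_of_ae_abs_deriv_le (f := fun r => (x.Rh r j : Mat3) i k) hst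
    (h.estimate_ac hs ht i k) ?_
  filter_upwards [h.solution.flow_Rh j] with r hr hrm
  have hint := Ioo_subset_interior_slice h.solution.dom hs ht hrm
  refine ⟨_, hr hint i k, (abs_entry_le_frobNorm _ i k).trans ?_⟩
  rw [SO3.frobNorm_mul_left, frobNorm_hat]
  refine mul_le_mul_of_nonneg_left ?_ (Real.sqrt_nonneg _)
  refine (euclNorm_add_le _ _).trans (add_le_add ?_ ?_)
  · rw [add_sub_assoc]
    refine (euclNorm_add_le _ _).trans (add_le_add (h.ω_le r ?_) (hB r ?_))
    · exact h.t₀_nonneg.trans (h.solution.dom.le_of_mem (interior_subset (s := x.slice j) hint))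
    · exact Set.Ioo_subset_Icc_self hrm
  · rw [euclNorm_smul, abs_of_pos hP.γP_pos]
    exact mul_le_mul_of_nonneg_left (h.innovation_flow_le hP hint) hP.γP_pos.le

theorem exists_bias_bound (hs : s ∈ x.slice j) (ht : t ∈ x.slice j) (hst : s ≤ t) :
    ∃ B, 0 ≤ B ∧ ∀ r ∈ Set.Icc s t, euclNorm (b - x.bh r j) ≤ B := by
  set C := P.γI * (Real.sqrt (α₄ / 2) * 2) * (t - s) with hC
  have hγ := hP.γI_pos
  have hC0 : 0 ≤ C := mul_nonneg (by positivity) (sub_nonneg.2 hst)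
  refine ⟨euclNorm (b - x.bh s j) + 2 * C,
    add_nonneg (euclNorm_nonneg _) (by positivity), fun r hr => ?_⟩
  have hrs := Icc_subset_slice h.solution.dom hs ht hr
  have h2 : euclNorm (x.bh s j - x.bh r j) ≤ 2 * C := euclNorm_le_of_coord_le fun i => by
    rw [Pi.sub_apply, abs_sub_comm]
    refine (h.bias_lipschitz hP hs hrs hr.1 i).trans ?_
    exact mul_le_mul_of_nonneg_left (by linarith [hr.2]) (by positivity)
  calc _ = euclNorm ((b - x.bh s j) + (x.bh s j - x.bh r j)) := by congr 1; abel
    _ ≤ _ := (euclNorm_add_le _ _).trans (by linarith)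

/-- `Φ` is absolutely continuous along flows: the attitude error is Lipschitz there, and the
gradient of `Φ` is bounded on the flow set. -/
theorem potential_ac [Finite Q] (hs : s ∈ x.slice j) (ht : t ∈ x.slice j) (hst : s ≤ t) :
    AbsolutelyContinuousOnInterval (fun r => P.Φ (x.Rt R r j) (x.q s j)) s t := by
  rcases hst.eq_or_lt with rfl | hlt
  · exact absolutelyContinuousOnInterval_of_abs_sub_le (C := 0) le_rfl fun y hy z hz _ => by
      rw [Set.Icc_self] at hy hz
      rw [Set.mem_singleton_iff.1 hy, Set.mem_singleton_iff.1 hz]; simp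
  obtain ⟨B, hB0, hB⟩ := h.exists_bias_bound hP hs ht hst
  set L₁ := 3 * (Real.sqrt 2 * c)
  set L₂ := 3 * (Real.sqrt 2 * (c + B + P.γP * (Real.sqrt (α₄ / 2) * 2)))
  have hc := h.c_nonneg
  have hγ := hP.γP_pos
  have hL : 0 ≤ L₁ + L₂ := by positivity
  have hsub := Icc_subset_slice h.solution.dom hs ht
  have hlip : ∀ y ∈ Set.Icc s t, ∀ z ∈ Set.Icc s t, y ≤ z →
      frobNorm ((x.Rt R z j : Mat3) - (x.Rt R y j : Mat3)) ≤ (L₁ + L₂) * (z - y) := by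
    intro y hy z hz hyz
    have e : (x.Rt R z j : Mat3) - (x.Rt R y j : Mat3) =
        ((R z : Mat3) - (R y : Mat3)) * (x.Rh z j : Mat3)ᵀ +
          (R y : Mat3) * ((x.Rh z j : Mat3) - (x.Rh y j : Mat3))ᵀ := by
      rw [coe_Rt, coe_Rt, Matrix.transpose_sub]; noncomm_ring
    rw [e, add_mul]
    refine (frobNorm_add_le _ _).trans (add_le_add ?_ ?_)
    · rw [SO3.frobNorm_mul_transpose]
      exact h.attitude_lipschitz (h.solution.dom.le_of_mem (hsub hy)) hyz
    · rw [SO3.frobNorm_mul_left, frobNorm_transpose]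
      exact h.estimate_lipschitz hP (hsub hy) (hsub hz) hyz fun r hr =>
        hB r ⟨hy.1.trans hr.1, hr.2.trans hz.2⟩
  refine absolutelyContinuousOnInterval_of_abs_sub_le
    (C := Real.sqrt (α₄ * 2 ^ 2) * (L₁ + L₂)) hst fun y hy z hz hyz => ?_
  refine abs_sub_le_of_hasGradSO3 (f := fun X => P.Φ X (x.q s j)) (γ := fun r => x.Rt R r j) hL
    (fun u hu v hv => hlip u ⟨hy.1.trans hu.1, hu.2.trans hz.2⟩ v ⟨hy.1.trans hv.1, hv.2.trans hz.2⟩)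
    (hP.potential.continuous _) (fun r hr => ?_) hyz
  have hmem := h.flow_mem_Icc hP.potential.continuous hs ht hlt
    (r := r) ⟨hy.1.trans hr.1, hr.2.trans hz.2⟩
  refine ⟨_, gradSO3_spec (hP.diffAt hmem), Real.le_sqrt_of_sq_le ?_⟩
  refine (hP.grad _ _ hmem).2.trans (mul_le_mul_of_nonneg_left ?_ hP.α₄_pos.le)
  exact pow_le_pow_left₀ (attNorm_nonneg _) (attNorm_le_two _) 2

end Flow

/-! ### Derivatives of the error functions along flows -/

theorem attitude_error_ac (h : IsRun P c t₀ ω b R x) (hs : s ∈ x.slice j) (ht : t ∈ x.slice j)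
    (i k : Fin 3) :
    AbsolutelyContinuousOnInterval (fun r => (((x.Rh r j)⁻¹ * R r : SO3) : Mat3) i k) s t :=
  absolutelyContinuousOnInterval_mul_entry (A := fun r => (x.Rh r j : Mat3)ᵀ)
    (fun i k => h.estimate_ac hs ht k i) (h.attitude_ac hs ht) i k

theorem bias_error_sq_ac (h : IsRun P c t₀ ω b R x) (hs : s ∈ x.slice j) (ht : t ∈ x.slice j) :
    AbsolutelyContinuousOnInterval (fun r => euclNorm (b - x.bh r j) ^ 2) s t := by
  simp only [euclNorm_sq, dotProduct]
  exact absolutelyContinuousOnInterval_sum fun i _ =>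
    (h.bias_error_ac hs ht i).fun_mul (h.bias_error_ac hs ht i)

theorem cross_ac (h : IsRun P c t₀ ω b R x) (hs : s ∈ x.slice j) (ht : t ∈ x.slice j) :
    AbsolutelyContinuousOnInterval (fun r => frobInner (hat (b - x.bh r j))
      (((x.Rh r j)⁻¹ * R r : SO3) : Mat3)) s t :=
  absolutelyContinuousOnInterval_frobInner
    (absolutelyContinuousOnInterval_hat_entry (h.bias_error_ac hs ht)) (h.attitude_error_ac hs ht)

/-- Derivatives of the three parts of the Lyapunov function. The drift of the potential is
`-2 ⟨β, b̃ + γP β⟩`; the angular velocity has dropped out of it. -/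
theorem hasDerivAt_flow (hP : Admissible P D α₁ α₂ α₃ α₄) (h : IsRun P c t₀ ω b R x)
    (hs : s ∈ x.slice j) (ht : t ∈ x.slice j) :
    ∀ᵐ r : ℝ, r ∈ Set.Ioo s t → ∃ β, β = innovation P.Φ (x.Rt R r j) (x.Rh r j) (x.q r j) ∧
      HasDerivAt (fun r => P.Φ (x.Rt R r j) (x.q s j)) (-2 * (β ⬝ᵥ (b - x.bh r j + P.γP • β))) r ∧
      HasDerivAt (fun r => euclNorm (b - x.bh r j) ^ 2) (2 * P.γI * (β ⬝ᵥ (b - x.bh r j))) r ∧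
      HasDerivAt (fun r => frobInner (hat (b - x.bh r j)) (((x.Rh r j)⁻¹ * R r : SO3) : Mat3))
        (frobInner (hat (P.γI • β)) (((x.Rh r j)⁻¹ * R r : SO3) : Mat3) +
          frobInner (hat (b - x.bh r j)) ((((x.Rh r j)⁻¹ * R r : SO3) : Mat3) * hat (ω r) -
            hat (ω r + (b - x.bh r j) + P.γP • β) * (((x.Rh r j)⁻¹ * R r : SO3) : Mat3))) r := by
  filter_upwards [h.attitude.deriv, h.solution.flow_Rh j, h.solution.flow_bh j]
    with r hR hRh hbh hrm
  have hint := Ioo_subset_interior_slice h.solution.dom hs ht hrm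
  have hq : x.q s j = x.q r j := h.solution.flow_q j s hs r (interior_subset hint)
  replace hR := hR ((h.solution.dom.le_of_mem hs).trans_lt hrm.1)
  replace hRh := hRh hint
  replace hbh := hbh hint
  have hmem := h.solution.flow_mem j r hint
  set β := innovation P.Φ (x.Rt R r j) (x.Rh r j) (x.q r j) with hβ
  set v := b - x.bh r j with hv
  have hu : (ω r + b) - x.bh r j + P.γP • β = ω r + v + P.γP • β := by rw [hv]; abel
  rw [hu] at hRh
  have hverr : ∀ i, HasDerivAt (fun r => (b - x.bh r j) i) ((P.γI • β) i) r := fun i => by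
    simpa using (hbh i).const_sub (b i)
  refine ⟨β, rfl, ?_, ?_, ?_⟩
  · have hd : ∀ i k, HasDerivAt (fun r => (x.Rt R r j : Mat3) i k)
        ((-((R r : Mat3) * hat (v + P.γP • β) * (x.Rh r j : Mat3)ᵀ)) i k) r := fun i k => by
      have := hasDerivAt_mul_entry (A := fun r => (R r : Mat3)) (B := fun r => (x.Rh r j : Mat3)ᵀ)
        (B' := ((x.Rh r j : Mat3) * hat (ω r + v + P.γP • β))ᵀ) hR (fun i k => hRh k i) i k
      refine this.congr_deriv (congrFun (congrFun ?_ i) k)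
      rw [Matrix.transpose_mul, hat_transpose, add_assoc, hat_add, Matrix.mul_assoc, Matrix.mul_assoc,
        ← Matrix.mul_add, ← Matrix.mul_neg]
      congr 1
      noncomm_ring
    have hgrad := (gradSO3_spec (hP.diffAt hmem)).hasDerivAt_comp (γ := fun r => x.Rt R r j)
      (A := -((R r : Mat3) * hat (v + P.γP • β) * (x.Rh r j : Mat3)ᵀ)) hd
    rw [hq]
    refine hgrad.congr_deriv ?_
    have e := gradSO3_eq_innovation (hP.diffAt hmem)
    change gradSO3 _ (x.Rt R r j) = (R r : Mat3) * hat β * (x.Rh r j : Mat3)ᵀ at e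
    rw [e]
    have e2 : ∀ A C : Mat3, frobInner A (-C) = -frobInner A C := fun A C => by
      rw [frobInner, Matrix.mul_neg, Matrix.trace_neg]; rfl
    rw [e2, ← coe_inv_SO3, SO3.frobInner_mul_right, SO3.frobInner_mul_left, frobInner_hat_hat]
    ring
  · simp only [euclNorm_sq, dotProduct]
    have := HasDerivAt.fun_sum (u := Finset.univ) fun i (_ : i ∈ Finset.univ) =>
      (hverr i).fun_mul (hverr i)
    refine this.congr_deriv ?_
    simp only [Pi.smul_apply, smul_eq_mul, Finset.mul_sum]
    refine Finset.sum_congr rfl fun i _ => ?_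
    rw [hv]; ring
  · have hY : ∀ i k, HasDerivAt (fun r => (((x.Rh r j)⁻¹ * R r : SO3) : Mat3) i k)
        (((((x.Rh r j)⁻¹ * R r : SO3) : Mat3) * hat (ω r) -
            hat (ω r + v + P.γP • β) * (((x.Rh r j)⁻¹ * R r : SO3) : Mat3)) i k) r := fun i k => by
      have := hasDerivAt_mul_entry (A := fun r => (x.Rh r j : Mat3)ᵀ) (B := fun r => (R r : Mat3))
        (A' := ((x.Rh r j : Mat3) * hat (ω r + v + P.γP • β))ᵀ) (fun i k => hRh k i) hR i k
      refine this.congr_deriv (congrFun (congrFun ?_ i) k)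
      change _ = (x.Rh r j : Mat3)ᵀ * (R r : Mat3) * hat (ω r) -
        hat (ω r + v + P.γP • β) * ((x.Rh r j : Mat3)ᵀ * (R r : Mat3))
      rw [Matrix.transpose_mul, hat_transpose]
      noncomm_ring
    exact hasDerivAt_frobInner (hasDerivAt_hat_entry hverr) hY

end IsRun

end

section

variable {Q : Type*} {P : Design Q} {D : Set (SO3 × Q)} {α₁ α₂ α₃ α₄ c t₀ : ℝ}
  {ω : ℝ → Fin 3 → ℝ} {b : Fin 3 → ℝ} {R : ℝ → SO3} {x : Arc Q} {j : ℕ} {s t B : ℝ}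

/-! ### The energy `Φ + ‖b̃‖² / γI` -/

/-- The energy of the estimation error, nonincreasing along solutions and dropping by at least `δ`
at every jump. -/
noncomputable def energy (P : Design Q) (R : ℝ → SO3) (b : Fin 3 → ℝ) (x : Arc Q) (t : ℝ) (j : ℕ) :
    ℝ :=
  P.Φ (x.Rt R t j) (x.q t j) + 1 / P.γI * euclNorm (b - x.bh t j) ^ 2

theorem Rt_jump (h : IsSolution P t₀ ω b R x) (ht : (t, j) ∈ x.dom) (ht' : (t, j + 1) ∈ x.dom) :
    x.Rt R t (j + 1) = x.Rt R t j := by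
  rw [Arc.Rt, Arc.Rt, h.jump_Rh t j ht ht']

theorem energy_jump [Finite Q] (h : IsSolution P t₀ ω b R x) (ht : (t, j) ∈ x.dom)
    (ht' : (t, j + 1) ∈ x.dom) : energy P R b x t (j + 1) + P.δ ≤ energy P R b x t j := by
  have h1 := add_le_of_mem_jumpSet (h.jump_mem t j ht ht') (h.jump_q t j ht ht')
  rw [energy, energy, Rt_jump h ht ht', h.jump_bh t j ht ht']
  linarith

theorem energy_flow [Finite Q] (hP : Admissible P D α₁ α₂ α₃ α₄) (h : IsRun P c t₀ ω b R x)
    (hs : s ∈ x.slice j) (ht : t ∈ x.slice j) (hst : s ≤ t) :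
    energy P R b x t j ≤ energy P R b x s j := by
  have hγ := hP.γI_pos
  have := sub_le_of_ae_deriv_le (C := 0) hst
    ((h.potential_ac hP hs ht hst).fun_add ((h.bias_error_sq_ac hs ht).const_mul (1 / P.γI))) (by
      filter_upwards [h.hasDerivAt_flow hP hs ht] with r hr hrm
      obtain ⟨β, -, h1, h2, -⟩ := hr hrm
      refine ⟨_, h1.fun_add (h2.const_mul (1 / P.γI)), ?_⟩
      have e : 1 / P.γI * (2 * P.γI * (β ⬝ᵥ (b - x.bh r j))) = 2 * (β ⬝ᵥ (b - x.bh r j)) := by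
        field_simp
      rw [e, dotProduct_add, dotProduct_smul, ← euclNorm_sq, smul_eq_mul]
      have := mul_nonneg hP.γP_pos.le (sq_nonneg (euclNorm β))
      linarith)
  rw [energy, energy, h.solution.flow_q j t ht s hs]
  linarith

/-- The `j`-th slice is reached only after the energy has dropped by `δ` at each of `j` jumps. -/
theorem energy_le [Finite Q] (hP : Admissible P D α₁ α₂ α₃ α₄) (h : IsRun P c t₀ ω b R x)
    (ht : (t, j) ∈ x.dom) : energy P R b x t j + P.δ * j ≤ energy P R b x t₀ 0 := by
  induction j generalizing t with
  | zero =>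
    simpa using energy_flow hP h h.solution.dom.initial_mem ht (h.solution.dom.le_of_mem ht)
  | succ j ih =>
    obtain ⟨s, hst, hs, hs'⟩ := h.solution.dom.exists_jump_le ht
    have h1 := energy_flow hP h hs' ht hst
    have h2 := energy_jump h.solution hs hs'
    have h3 := ih hs
    push_cast
    linarith

theorem errSq_nonneg : 0 ≤ x.errSq R b t j := add_nonneg (sq_nonneg _) (sq_nonneg _)

section Bounds

variable (hP : Admissible P D α₁ α₂ α₃ α₄)
include hP

theorem le_energy : min α₁ (1 / P.γI) * x.errSq R b t j ≤ energy P R b x t j := by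
  rw [energy, Arc.errSq, mul_add]
  exact add_le_add
    ((mul_le_mul_of_nonneg_right (min_le_left _ _) (sq_nonneg _)).trans (hP.quad _ _).1)
    (mul_le_mul_of_nonneg_right (min_le_right _ _) (sq_nonneg _))

theorem energy_le_errSq : energy P R b x t j ≤ max α₂ (1 / P.γI) * x.errSq R b t j := by
  rw [energy, Arc.errSq, mul_add]
  exact add_le_add
    ((hP.quad _ _).2.trans (mul_le_mul_of_nonneg_right (le_max_left _ _) (sq_nonneg _)))
    (mul_le_mul_of_nonneg_right (le_max_right _ _) (sq_nonneg _))

theorem bias_error_le_of_energy_le {C : ℝ} (hC : energy P R b x t j ≤ C) :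
    euclNorm (b - x.bh t j) ≤ Real.sqrt (P.γI * C) := by
  refine Real.le_sqrt_of_sq_le ?_
  have hΦ : 0 ≤ P.Φ (x.Rt R t j) (x.q t j) :=
    (mul_nonneg hP.α₁_pos.le (sq_nonneg _)).trans (hP.quad _ _).1
  rw [energy] at hC
  have hγ := hP.γI_pos
  calc euclNorm (b - x.bh t j) ^ 2 = P.γI * (1 / P.γI * euclNorm (b - x.bh t j) ^ 2) := by
        field_simp
    _ ≤ P.γI * C := mul_le_mul_of_nonneg_left (by linarith) hγ.le

end Bounds

/-! ### The strict Lyapunov function -/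

/-- The energy plus the multiple `μ` of the cross term `½ ⟨⟨[b̃]_×, R̂ᵀ R⟩⟩`. -/
noncomputable def lyapunov (P : Design Q) (μ : ℝ) (R : ℝ → SO3) (b : Fin 3 → ℝ) (x : Arc Q) (t : ℝ)
    (j : ℕ) : ℝ :=
  energy P R b x t j +
    μ * (frobInner (hat (b - x.bh t j)) (((x.Rh t j)⁻¹ * R t : SO3) : Mat3) / 2)

theorem lyapunov_jump [Finite Q] {μ : ℝ} (hδ : 0 < P.δ) (h : IsSolution P t₀ ω b R x)
    (ht : (t, j) ∈ x.dom) (ht' : (t, j + 1) ∈ x.dom) :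
    lyapunov P μ R b x t (j + 1) ≤ lyapunov P μ R b x t j := by
  have := energy_jump h ht ht'
  rw [lyapunov, lyapunov, h.jump_Rh t j ht ht', h.jump_bh t j ht ht']
  linarith

theorem abs_lyapunov_sub_energy_le {μ : ℝ} (hμ : 0 ≤ μ) :
    |lyapunov P μ R b x t j - energy P R b x t j| ≤ μ * x.errSq R b t j := by
  rw [lyapunov, add_sub_cancel_left, abs_mul, abs_of_nonneg hμ]
  refine mul_le_mul_of_nonneg_left ?_ hμ
  have := abs_cross_term_le ((x.Rh t j)⁻¹ * R t) (b - x.bh t j)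
  rwa [attNorm_inv_mul] at this

/-- Young's inequality absorbs the mixed terms in the derivative of the cross term. -/
theorem cross_term_bound {gP gI a B c n v β w : ℝ} (hP : 0 ≤ gP) (hI : 0 ≤ gI) (ha : 0 ≤ a)
    (hn : 0 ≤ n) (hn2 : n ≤ 2) (hv : 0 ≤ v) (hvB : v ≤ B) (hβ : β ≤ a * n) (hwc : w ≤ c) :
    -v ^ 2 + gP * v * β + 2 * gI * β * n + 3 * (v + gP * β + 2 * w) * v * n ≤
      -(v ^ 2 / 2) +
        ((gP * a + 3 * (B + gP * (a * 2) + 2 * c)) ^ 2 / 2 + 2 * gI * a) * n ^ 2 := by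
  have h1 : gP * v * β ≤ gP * v * (a * n) := mul_le_mul_of_nonneg_left hβ (by positivity)
  have h2 : 2 * gI * β * n ≤ 2 * gI * (a * n) * n :=
    mul_le_mul_of_nonneg_right (mul_le_mul_of_nonneg_left hβ (by positivity)) hn
  have h3 : gP * β ≤ gP * (a * 2) :=
    mul_le_mul_of_nonneg_left (hβ.trans (mul_le_mul_of_nonneg_left hn2 ha)) hP
  have h4 : 3 * (v + gP * β + 2 * w) * v * n ≤ 3 * (B + gP * (a * 2) + 2 * c) * v * n := by
    refine mul_le_mul_of_nonneg_right (mul_le_mul_of_nonneg_right ?_ hv) hn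
    linarith
  have h5 := sq_nonneg (v - (gP * a + 3 * (B + gP * (a * 2) + 2 * c)) * n)
  nlinarith

/-- A single weight `μ` and a single rate serve all solutions whose bias error is bounded by `B`
and whose angular velocity is bounded by `c`. -/
theorem exists_lyapunov_decay [Finite Q] (hP : Admissible P D α₁ α₂ α₃ α₄) (B c : ℝ) :
    ∃ μ lam : ℝ, 0 < μ ∧ μ ≤ min α₁ (1 / P.γI) / 2 ∧ 0 < lam ∧
      ∀ (t₀ : ℝ) (ω : ℝ → Fin 3 → ℝ) (b : Fin 3 → ℝ) (R : ℝ → SO3) (x : Arc Q),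
        IsRun P c t₀ ω b R x → (∀ t j, (t, j) ∈ x.dom → euclNorm (b - x.bh t j) ≤ B) →
        ∀ j, ∀ s ∈ x.slice j, ∀ t ∈ x.slice j, s ≤ t →
          lyapunov P μ R b x t j ≤ Real.exp (-lam * (t - s)) * lyapunov P μ R b x s j := by
  have hγP := hP.γP_pos
  have hγI := hP.γI_pos
  have hα₁ := hP.α₁_pos
  have hα₂ := hP.α₂_pos
  have hα₃ := hP.α₃_pos
  set a := Real.sqrt (α₄ / 2) with ha
  have ha0 : 0 ≤ a := Real.sqrt_nonneg _
  set C₃ := (P.γP * a + 3 * (B + P.γP * (a * 2) + 2 * c)) ^ 2 / 2 + 2 * P.γI * a with hC₃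
  have hC₃0 : 0 ≤ C₃ := by positivity
  set m := min α₁ (1 / P.γI) with hm
  have hm0 : 0 < m := lt_min hα₁ (by positivity)
  set μ := min (m / 2) (P.γP * α₃ / (2 * (C₃ + 1))) with hμ
  have hμ0 : 0 < μ := lt_min (by positivity) (by positivity)
  have hμm : μ ≤ m / 2 := min_le_left _ _
  have hμC : μ * C₃ ≤ P.γP * α₃ / 2 := by
    calc μ * C₃ ≤ P.γP * α₃ / (2 * (C₃ + 1)) * (C₃ + 1) :=
          mul_le_mul (min_le_right _ _) (by linarith) hC₃0 (by positivity)
      _ = P.γP * α₃ / 2 := by field_simp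
  set κ := min (P.γP * α₃ / 2) (μ / 2) with hκ
  have hκ0 : 0 < κ := lt_min (by positivity) (by positivity)
  set K := max α₂ (1 / P.γI) + μ with hK
  have hK0 : 0 < K := by
    have : 0 < max α₂ (1 / P.γI) := lt_max_of_lt_left hα₂
    positivity
  refine ⟨μ, κ / K, hμ0, hμm, by positivity, fun t₀ ω b R x h hbd j s hs t ht hst => ?_⟩
  have hq : ∀ r ∈ x.slice j, lyapunov P μ R b x r j =
      (P.Φ (x.Rt R r j) (x.q s j) + 1 / P.γI * euclNorm (b - x.bh r j) ^ 2) +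
        μ / 2 * frobInner (hat (b - x.bh r j)) (((x.Rh r j)⁻¹ * R r : SO3) : Mat3) := by
    intro r hr
    rw [lyapunov, energy, h.solution.flow_q j r hr s hs]
    ring
  rw [hq t ht, hq s hs]
  refine le_exp_mul_of_ae_deriv_le hst (((h.potential_ac hP hs ht hst).fun_add
    ((h.bias_error_sq_ac hs ht).const_mul (1 / P.γI))).fun_add
    ((h.cross_ac hs ht).const_mul (μ / 2))) ?_
  filter_upwards [h.hasDerivAt_flow hP hs ht] with r hr hrm
  obtain ⟨β, hβ, h1, h2, h3⟩ := hr hrm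
  refine ⟨_, (h1.fun_add (h2.const_mul (1 / P.γI))).fun_add (h3.const_mul (μ / 2)), ?_⟩
  have hint := Ioo_subset_interior_slice h.solution.dom hs ht hrm
  have hrx : r ∈ x.slice j := interior_subset hint
  rw [← hq r hrx]
  have hflow := hP.innovation_sq (h.solution.flow_mem j r hint)
  change α₃ / 2 * attNorm (x.Rt R r j) ^ 2 ≤
      euclNorm (innovation P.Φ (x.Rt R r j) (x.Rh r j) (x.q r j)) ^ 2 ∧
      euclNorm (innovation P.Φ (x.Rt R r j) (x.Rh r j) (x.q r j)) ≤ a * attNorm (x.Rt R r j)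
    at hflow
  rw [← hβ] at hflow
  have hY := cross_term_deriv_le ((x.Rh r j)⁻¹ * R r) (b - x.bh r j) β (ω r) P.γP P.γI hγP.le hγI.le
  rw [attNorm_inv_mul] at hY
  change _ ≤ -euclNorm (b - x.bh r j) ^ 2 + P.γP * euclNorm (b - x.bh r j) * euclNorm β +
      2 * P.γI * euclNorm β * attNorm (x.Rt R r j) +
      3 * (euclNorm (b - x.bh r j) + P.γP * euclNorm β + 2 * euclNorm (ω r)) *
        euclNorm (b - x.bh r j) * attNorm (x.Rt R r j) at hY
  have hY2 := hY.trans (cross_term_bound hγP.le hγI.le ha0 (attNorm_nonneg _) (attNorm_le_two _)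
    (euclNorm_nonneg _) (hbd r j hrx) hflow.2
    (h.ω_le r (h.t₀_nonneg.trans (h.solution.dom.le_of_mem hrx))))
  rw [← hC₃] at hY2
  have hY3 := mul_le_mul_of_nonneg_left hY2 hμ0.le
  have e : 1 / P.γI * (2 * P.γI * (β ⬝ᵥ (b - x.bh r j))) = 2 * (β ⬝ᵥ (b - x.bh r j)) := by
    field_simp
  rw [e, dotProduct_add, dotProduct_smul, ← euclNorm_sq, smul_eq_mul]
  have hV : lyapunov P μ R b x r j ≤ K * x.errSq R b r j := by
    have h4 := (abs_le.1 (abs_lyapunov_sub_energy_le (P := P) (R := R) (b := b) (x := x) (t := r)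
      (j := j) hμ0.le)).2
    have h5 := energy_le_errSq (R := R) (b := b) (x := x) (t := r) (j := j) hP
    rw [hK, add_mul]
    linarith
  have hV2 : κ / K * lyapunov P μ R b x r j ≤ κ * x.errSq R b r j := by
    calc _ ≤ κ / K * (K * x.errSq R b r j) := mul_le_mul_of_nonneg_left hV (by positivity)
      _ = _ := by field_simp
  have h6 := mul_le_mul_of_nonneg_left hflow.1 hγP.le
  have h7 := mul_le_mul_of_nonneg_right hμC (sq_nonneg (attNorm (x.Rt R r j)))
  have h8 := mul_le_mul_of_nonneg_right (min_le_left (P.γP * α₃ / 2) (μ / 2))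
    (sq_nonneg (attNorm (x.Rt R r j)))
  have h9 := mul_le_mul_of_nonneg_right (min_le_right (P.γP * α₃ / 2) (μ / 2))
    (sq_nonneg (euclNorm (b - x.bh r j)))
  rw [Arc.errSq] at hV2
  linarith

theorem lyapunov_le_exp [Finite Q] {μ lam : ℝ} (hδ : 0 < P.δ) (h : IsSolution P t₀ ω b R x)
    (hdec : ∀ j, ∀ s ∈ x.slice j, ∀ t ∈ x.slice j, s ≤ t →
      lyapunov P μ R b x t j ≤ Real.exp (-lam * (t - s)) * lyapunov P μ R b x s j)
    (ht : (t, j) ∈ x.dom) :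
    lyapunov P μ R b x t j ≤ Real.exp (-lam * (t - t₀)) * lyapunov P μ R b x t₀ 0 := by
  induction j generalizing t with
  | zero => exact hdec 0 t₀ h.dom.initial_mem t ht (h.dom.le_of_mem ht)
  | succ j ih =>
    obtain ⟨s, hst, hs, hs'⟩ := h.dom.exists_jump_le ht
    refine (hdec (j + 1) s hs' t ht hst).trans ?_
    have h1 := (lyapunov_jump (μ := μ) hδ h hs hs').trans (ih hs)
    refine (mul_le_mul_of_nonneg_left h1 (Real.exp_pos _).le).trans (le_of_eq ?_)
    rw [← mul_assoc, ← Real.exp_add]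
    ring_nf

/-- Exponential decay of the error in continuous time. The overshoot factor depends on the design
only, because the weight of the cross term is at most half of the lower bound of the energy. -/
theorem exists_errSq_decay [Finite Q] (hP : Admissible P D α₁ α₂ α₃ α₄) (B c : ℝ) :
    ∃ lam : ℝ, 0 < lam ∧
      ∀ (t₀ : ℝ) (ω : ℝ → Fin 3 → ℝ) (b : Fin 3 → ℝ) (R : ℝ → SO3) (x : Arc Q),
        IsRun P c t₀ ω b R x → (∀ t j, (t, j) ∈ x.dom → euclNorm (b - x.bh t j) ≤ B) →
        ∀ t j, (t, j) ∈ x.dom →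
          x.errSq R b t j ≤ (2 * max α₂ (1 / P.γI) / min α₁ (1 / P.γI) + 1) *
            Real.exp (-lam * (t - t₀)) * x.errSq R b t₀ 0 := by
  obtain ⟨μ, lam, hμ0, hμm, hlam, H⟩ := exists_lyapunov_decay hP B c
  refine ⟨lam, hlam, fun t₀ ω b R x h hbd t j ht => ?_⟩
  have hV := lyapunov_le_exp hP.δ_pos h.solution (H t₀ ω b R x h hbd) ht
  set m := min α₁ (1 / P.γI) with hm
  have hγ := hP.γI_pos
  have hm0 : 0 < m := lt_min hP.α₁_pos (by positivity)
  have h1 := (abs_le.1 (abs_lyapunov_sub_energy_le (P := P) (R := R) (b := b) (x := x) (t := t)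
      (j := j) hμ0.le)).1
  have h2 := (abs_le.1 (abs_lyapunov_sub_energy_le (P := P) (R := R) (b := b) (x := x) (t := t₀)
      (j := 0) hμ0.le)).2
  have h3 := le_energy (R := R) (b := b) (x := x) (t := t) (j := j) hP
  have h4 := energy_le_errSq (R := R) (b := b) (x := x) (t := t₀) (j := 0) hP
  rw [← hm] at h3
  have e0 := errSq_nonneg (R := R) (b := b) (x := x) (t := t) (j := j)
  have e1 := errSq_nonneg (R := R) (b := b) (x := x) (t := t₀) (j := 0)
  have h5 := mul_le_mul_of_nonneg_right hμm e0
  have h6 := mul_le_mul_of_nonneg_right hμm e1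
  have h7 : lyapunov P μ R b x t₀ 0 ≤ (max α₂ (1 / P.γI) + m / 2) * x.errSq R b t₀ 0 := by
    rw [add_mul]; linarith
  have h8 : m / 2 * x.errSq R b t j ≤
      Real.exp (-lam * (t - t₀)) * ((max α₂ (1 / P.γI) + m / 2) * x.errSq R b t₀ 0) := by
    refine le_trans ?_ (hV.trans (mul_le_mul_of_nonneg_left h7 (Real.exp_pos _).le))
    linarith
  have h9 := mul_le_mul_of_nonneg_left h8 (show (0 : ℝ) ≤ 2 / m by positivity)
  calc x.errSq R b t j = 2 / m * (m / 2 * x.errSq R b t j) := by field_simp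
    _ ≤ _ := h9
    _ = _ := by field_simp

end

section

variable {Q : Type*}

/-! ### Local existence of flows -/

theorem isClosed_SO3 : IsClosed {A : Mat3 | A ∈ specialOrthogonalGroup (Fin 3) ℝ} := by
  simp only [mem_SO3_iff, Set.ofPred_and]
  exact (isClosed_eq (continuous_id.matrix_mul continuous_id.matrix_transpose)
    continuous_const).inter (isClosed_eq continuous_id.matrix_det continuous_const)

theorem isClosedEmbedding_coe_SO3 : IsClosedEmbedding (fun X : SO3 => (X : Mat3)) :=
  isClosed_SO3.isClosedEmbedding_subtypeVal

theorem continuous_vee : Continuous vee := by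
  refine continuous_pi fun i => ?_
  fin_cases i
  · exact continuous_id.matrix_elem 2 1
  · exact continuous_id.matrix_elem 0 2
  · exact continuous_id.matrix_elem 1 0

theorem continuous_hat_entry {α : Type*} [TopologicalSpace α] {v : α → Fin 3 → ℝ}
    (hv : Continuous v) (i k : Fin 3) : Continuous fun a => hat (v a) i k := by
  have h := fun l => (continuous_apply l).comp hv
  simp only [Function.comp_def] at h
  fin_cases i <;> fin_cases k <;> simp [hat, h, (h _).fun_neg, continuous_const]

/-- The differential equations of the observer at time `t`, for the estimates `Rh`, `bh` and a fixed
switching variable `q`. -/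
def FlowsAt (P : Design Q) (ω : ℝ → Fin 3 → ℝ) (b : Fin 3 → ℝ) (R : ℝ → SO3) (q : Q)
    (Rh : ℝ → SO3) (bh : ℝ → Fin 3 → ℝ) (t : ℝ) : Prop :=
  (∀ i k, HasDerivAt (fun s => (Rh s : Mat3) i k)
    (((Rh t : Mat3) * hat ((ω t + b) - bh t
      + P.γP • innovation P.Φ (R t * (Rh t)⁻¹) (Rh t) q)) i k) t) ∧
  ∀ i, HasDerivAt (fun s => bh s i)
    ((-(P.γI • innovation P.Φ (R t * (Rh t)⁻¹) (Rh t) q)) i) t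

theorem FlowsAt.congr {P : Design Q} {ω : ℝ → Fin 3 → ℝ} {b : Fin 3 → ℝ} {R : ℝ → SO3} {q : Q}
    {Rh Rh' : ℝ → SO3} {bh bh' : ℝ → Fin 3 → ℝ} {t : ℝ} (h : FlowsAt P ω b R q Rh bh t)
    (hR : Rh' =ᶠ[𝓝 t] Rh) (hb : bh' =ᶠ[𝓝 t] bh) : FlowsAt P ω b R q Rh' bh' t := by
  rw [FlowsAt, hR.eq_of_nhds, hb.eq_of_nhds]
  refine ⟨fun i k => (h.1 i k).congr_of_eventuallyEq ?_, fun i => (h.2 i).congr_of_eventuallyEq ?_⟩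
  · filter_upwards [hR] with s hs using by rw [hs]
  · filter_upwards [hb] with s hs using by rw [hs]

/-- Near a rotation outside the jump set, the body-frame gradient is the restriction of a continuous
map on all matrices. -/
theorem exists_gradient_extension [Finite Q] {P : Design Q} {D : Set (SO3 × Q)}
    {α₁ α₂ α₃ α₄ : ℝ} (hP : Admissible P D α₁ α₂ α₃ α₄) {X₀ : SO3} {q : Q}
    (hX₀ : (X₀, q) ∉ jumpSet P.Φ P.δ) :
    ∃ (Ψ : (Fin 3 → Fin 3 → ℝ) → Fin 3 → ℝ) (K : Set SO3), Continuous Ψ ∧ K ∈ 𝓝 X₀ ∧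
      ∀ X ∈ K, (X, q) ∉ jumpSet P.Φ P.δ ∧
        Ψ (X : Mat3) = vee ((X : Mat3)ᵀ * gradSO3 (fun Y => P.Φ Y q) X) := by
  have hreg : RegularSpace SO3 := isClosedEmbedding_coe_SO3.isInducing.regularSpace
  obtain ⟨K, hK, hKc, hKU⟩ := exists_mem_nhds_isClosed_subset
    ((isOpen_compl_jumpSet_section (δ := P.δ) hP.potential.continuous q).mem_nhds hX₀)
  have hgr : ContinuousOn (gradSO3 fun Y => P.Φ Y q) K :=
    (hP.potential.grad_continuousOn q).mono fun X hX =>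
      hP.flow_subset (compl_jumpSet_subset_flowSet (hKU hX))
  have hψ : Continuous fun X : K =>
      vee (((X : SO3) : Mat3)ᵀ * gradSO3 (fun Y => P.Φ Y q) (X : SO3)) :=
    continuous_vee.comp ((continuous_subtype_val.comp continuous_subtype_val).matrix_transpose.matrix_mul
      (continuousOn_iff_continuous_domRestrict.1 hgr))
  have hnormal : NormalSpace Mat3 := inferInstanceAs (NormalSpace (Fin 3 → Fin 3 → ℝ))
  obtain ⟨Ψ, hΨ⟩ := ContinuousMap.exists_extension'
    (isClosedEmbedding_coe_SO3.comp hKc.isClosedEmbedding_subtypeVal) ⟨_, hψ⟩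
  exact ⟨Ψ, K, Ψ.continuous, hK, fun X hX => ⟨hKU hX, congrFun hΨ ⟨X, hX⟩⟩⟩

/-- Outside the jump set the observer can flow for a positive time. In the variables `R̃` and `b̃`
the right-hand side does not involve the angular velocity and is continuous in time, so Peano's
theorem applies; `R̃ R̃ᵀ` is constant along the solution in the space of matrices. -/
theorem exists_local_flow [Finite Q] {P : Design Q} {D : Set (SO3 × Q)}
    {α₁ α₂ α₃ α₄ : ℝ} (hP : Admissible P D α₁ α₂ α₃ α₄) {R : ℝ → SO3} {ω : ℝ → Fin 3 → ℝ} {T L : ℝ}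
    (hRc : ContinuousOn R (Set.Ici T))
    (hRL : ∀ s t, T ≤ s → s ≤ t → frobNorm ((R t : Mat3) - (R s : Mat3)) ≤ L * (t - s))
    (hRd : ∀ᵐ t : ℝ, T < t → ∀ i k,
      HasDerivAt (fun s => (R s : Mat3) i k) (((R t : Mat3) * hat (ω t)) i k) t)
    (b : Fin 3 → ℝ) (Rh₀ : SO3) (bh₀ : Fin 3 → ℝ) (q : Q)
    (hq : (R T * Rh₀⁻¹, q) ∉ jumpSet P.Φ P.δ) :
    ∃ ε > 0, ∃ C, ∃ (Rn : ℝ → SO3) (bn : ℝ → Fin 3 → ℝ), Rn T = Rh₀ ∧ bn T = bh₀ ∧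
      (∀ s t, T ≤ s → s ≤ t → t ≤ T + ε →
        frobNorm ((Rn t : Mat3) - (Rn s : Mat3)) ≤ C * (t - s) ∧
        ∀ i, |bn t i - bn s i| ≤ C * (t - s)) ∧
      (∀ t ∈ Set.Icc T (T + ε), (R t * (Rn t)⁻¹, q) ∈ flowSet P.Φ P.δ) ∧
      ∀ᵐ t : ℝ, t ∈ Set.Ioo T (T + ε) → FlowsAt P ω b R q Rn bn t := by
  obtain ⟨Ψ, K, hΨ, hK, hKΨ⟩ := exists_gradient_extension hP hq
  set X₀ : SO3 := R T * Rh₀⁻¹ with hX₀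
  -- The right-hand side, on all matrices and all times.
  set Rc : ℝ → Mat3 := fun t => (R (max T t) : Mat3) with hRcdef
  have hRcc : Continuous Rc :=
    continuous_subtype_val.comp (hRc.comp_continuous (continuous_const.max continuous_id)
      fun t => le_max_left T t)
  set ζ : ℝ → (Fin 3 → Fin 3 → ℝ) × (Fin 3 → ℝ) → Fin 3 → ℝ := fun t y =>
    (Matrix.of y.1)ᵀ *ᵥ (Rc t *ᵥ y.2) + P.γP • Ψ y.1 with hζ
  set F : ℝ → (Fin 3 → Fin 3 → ℝ) × (Fin 3 → ℝ) → (Fin 3 → Fin 3 → ℝ) × (Fin 3 → ℝ) := fun t y =>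
    (fun i k => (-(Matrix.of y.1 * hat (ζ t y))) i k,
      P.γI • ((Rc t)ᵀ *ᵥ (Matrix.of y.1 *ᵥ Ψ y.1))) with hF
  have cof : Continuous fun p : ℝ × ((Fin 3 → Fin 3 → ℝ) × (Fin 3 → ℝ)) =>
      (Matrix.of p.2.1 : Mat3) := continuous_fst.comp continuous_snd
  have cR : Continuous fun p : ℝ × ((Fin 3 → Fin 3 → ℝ) × (Fin 3 → ℝ)) => Rc p.1 :=
    hRcc.comp continuous_fst
  have cΨ : Continuous fun p : ℝ × ((Fin 3 → Fin 3 → ℝ) × (Fin 3 → ℝ)) => Ψ p.2.1 :=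
    hΨ.comp (continuous_fst.comp continuous_snd)
  have cζ : Continuous fun p : ℝ × ((Fin 3 → Fin 3 → ℝ) × (Fin 3 → ℝ)) => ζ p.1 p.2 :=
    (cof.matrix_transpose.matrix_mulVec (cR.matrix_mulVec (continuous_snd.comp continuous_snd))).add
      (cΨ.const_smul P.γP)
  have cF : Continuous (Function.uncurry F) := by
    refine Continuous.prodMk (continuous_pi fun i => continuous_pi fun k => ?_) ?_
    · have chat : Continuous fun p : ℝ × ((Fin 3 → Fin 3 → ℝ) × (Fin 3 → ℝ)) =>
          hat (ζ p.1 p.2) := continuous_matrix fun i k => continuous_hat_entry cζ i k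
      exact ((cof.matrix_mul chat).neg).matrix_elem i k
    · exact (cR.matrix_transpose.matrix_mulVec (cof.matrix_mulVec cΨ)).const_smul P.γI
  obtain ⟨ε₀, hε₀, C, y, hy0, hyL, hyd⟩ := exists_local_solution cF T
    (fun i k => (X₀ : Mat3) i k, b - bh₀)
  set X : ℝ → Mat3 := fun t => Matrix.of (y t).1 with hX
  set v : ℝ → Fin 3 → ℝ := fun t => (y t).2 with hv
  have hXT : X T = X₀ := by rw [hX]; simp only [hy0]; rfl
  have hvT : v T = b - bh₀ := by rw [hv]; simp only [hy0]
  have hXc : Continuous X := continuous_fst.comp hyL.continuous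
  have hXd : ∀ t ∈ Set.Ioo T (T + ε₀), ∀ i k,
      HasDerivAt (fun s => X s i k) ((-(X t * hat (ζ t (y t)))) i k) t := fun t ht i k =>
    hasDerivAt_pi.1 (hasDerivAt_pi.1 (hyd t ht).fst i) k
  have hvd : ∀ t ∈ Set.Ioo T (T + ε₀), ∀ i,
      HasDerivAt (fun s => v s i) ((P.γI • ((Rc t)ᵀ *ᵥ (X t *ᵥ Ψ (X t)))) i) t := fun t ht i =>
    hasDerivAt_pi.1 (hyd t ht).snd i
  have hXL : ∀ s t, s ≤ t → ∀ i k, |X t i k - X s i k| ≤ C * (t - s) := by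
    intro s t hst i k
    have h1 := hyL.dist_le_mul t s
    rw [Real.dist_eq, abs_of_nonneg (sub_nonneg.2 hst)] at h1
    refine le_trans ?_ h1
    rw [← Real.dist_eq]
    exact ((dist_le_pi_dist ((y t).1 i) ((y s).1 i) k).trans
      (dist_le_pi_dist (y t).1 (y s).1 i)).trans (le_max_left _ _)
  have hvL : ∀ s t, s ≤ t → ∀ i, |v t i - v s i| ≤ C * (t - s) := by
    intro s t hst i
    have h1 := hyL.dist_le_mul t s
    rw [Real.dist_eq, abs_of_nonneg (sub_nonneg.2 hst)] at h1
    refine le_trans ?_ h1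
    rw [← Real.dist_eq]
    exact (dist_le_pi_dist (y t).2 (y s).2 i).trans (le_max_right _ _)
  have hXac : ∀ t, T ≤ t → ∀ i k, AbsolutelyContinuousOnInterval (fun s => X s i k) T t :=
    fun t ht i k => absolutelyContinuousOnInterval_of_abs_sub_le ht
      fun s _ r _ hsr => hXL s r hsr i k
  -- The flow preserves orthogonality.
  have horth : ∀ t ∈ Set.Icc T (T + ε₀), X t * (X t)ᵀ = 1 := by
    intro t ht
    ext i k
    have h1 := abs_sub_le_of_ae_abs_deriv_le (f := fun s => (X s * (X s)ᵀ) i k) (C := 0) ht.1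
      (absolutelyContinuousOnInterval_mul_entry (hXac t ht.1) (fun i k => hXac t ht.1 k i) i k)
      (Eventually.of_forall fun s hs => by
        have hs' : s ∈ Set.Ioo T (T + ε₀) := ⟨hs.1, hs.2.trans_le ht.2⟩
        have := hasDerivAt_mul_entry (A := X) (B := fun s => (X s)ᵀ)
          (B' := (-(X s * hat (ζ s (y s))))ᵀ) (hXd s hs') (fun i k => hXd s hs' k i) i k
        refine ⟨_, this, le_of_eq ?_⟩
        have e : -(X s * hat (ζ s (y s))) * (X s)ᵀ + X s * (-(X s * hat (ζ s (y s))))ᵀ = 0 := by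
          rw [Matrix.transpose_neg, Matrix.transpose_mul, hat_transpose]
          noncomm_ring
        rw [e]; simp)
    rw [zero_mul] at h1
    have h2 := sub_eq_zero.1 (abs_nonpos_iff.1 h1)
    rw [h2, hXT, SO3.mul_transpose]
  obtain ⟨η, hη, hnear⟩ : ∃ η > 0, ∀ t, dist t T < η →
      0 < (X t).det ∧ ∀ h : X t ∈ specialOrthogonalGroup (Fin 3) ℝ, (⟨X t, h⟩ : SO3) ∈ K := by
    refine Metric.eventually_nhds_iff.1 (Eventually.and ?_ ?_)
    · exact hXc.matrix_det.continuousAt.eventually_const_lt (by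
        change 0 < (X T).det
        rw [hXT, SO3.det_eq_one]; exact one_pos)
    · rw [nhds_subtype_eq_comap, mem_comap] at hK
      obtain ⟨O, hO, hOK⟩ := hK
      rw [← hXT] at hO
      filter_upwards [hXc.continuousAt hO] with t ht h
      exact hOK ht
  set ε := min ε₀ (η / 2) with hε
  have hε0 : 0 < ε := lt_min hε₀ (by positivity)
  have hdist : ∀ t ∈ Set.Icc T (T + ε), dist t T < η := fun t ht => by
    rw [Real.dist_eq, abs_of_nonneg (sub_nonneg.2 ht.1)]
    linarith [ht.2, min_le_right ε₀ (η / 2)]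
  have hIcc : ∀ t ∈ Set.Icc T (T + ε), t ∈ Set.Icc T (T + ε₀) := fun t ht =>
    ⟨ht.1, ht.2.trans (by linarith [min_le_left ε₀ (η / 2)])⟩
  have hXmem : ∀ t ∈ Set.Icc T (T + ε), X t ∈ specialOrthogonalGroup (Fin 3) ℝ := fun t ht => by
    have h1 := horth t (hIcc t ht)
    refine mem_SO3_iff.2 ⟨h1, ?_⟩
    have h2 := congrArg Matrix.det h1
    rw [Matrix.det_mul, Matrix.det_transpose, Matrix.det_one] at h2
    have h3 := (hnear t (hdist t ht)).1
    nlinarith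
  classical
  set Xs : ℝ → SO3 := fun t =>
    if h : X t ∈ specialOrthogonalGroup (Fin 3) ℝ then ⟨X t, h⟩ else 1 with hXs
  have hXsX : ∀ t ∈ Set.Icc T (T + ε), (Xs t : Mat3) = X t := fun t ht => by
    simp only [hXs, dif_pos (hXmem t ht)]
  have hXsK : ∀ t ∈ Set.Icc T (T + ε), Xs t ∈ K := fun t ht => by
    simp only [hXs, dif_pos (hXmem t ht)]
    exact (hnear t (hdist t ht)).2 _
  have hcancel : ∀ t, R t * ((Xs t)⁻¹ * R t)⁻¹ = Xs t := fun t => by group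
  have hTmem : T ∈ Set.Icc T (T + ε) := ⟨le_rfl, by linarith⟩
  refine ⟨ε, hε0, max (3 * C + L) C, fun t => (Xs t)⁻¹ * R t, fun t => b - v t, ?_, ?_, ?_, ?_, ?_⟩
  · have : Xs T = X₀ := Subtype.ext ((hXsX T hTmem).trans hXT)
    simp only [this, hX₀]; group
  · simp only [hvT]; abel
  · intro s t hs hst ht
    have hsI : s ∈ Set.Icc T (T + ε) := ⟨hs, hst.trans ht⟩
    have htI : t ∈ Set.Icc T (T + ε) := ⟨hs.trans hst, ht⟩
    constructor
    · have e : (((Xs t)⁻¹ * R t : SO3) : Mat3) - (((Xs s)⁻¹ * R s : SO3) : Mat3) =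
          ((Xs t : Mat3) - (Xs s : Mat3))ᵀ * (R t : Mat3) +
            (((Xs s)⁻¹ : SO3) : Mat3) * ((R t : Mat3) - (R s : Mat3)) := by
        change (Xs t : Mat3)ᵀ * (R t : Mat3) - (Xs s : Mat3)ᵀ * (R s : Mat3) = _ +
          (Xs s : Mat3)ᵀ * _
        rw [Matrix.transpose_sub]; noncomm_ring
      simp only [e]
      refine (frobNorm_add_le _ _).trans ?_
      rw [SO3.frobNorm_mul_left, SO3.frobNorm_mul_right, frobNorm_transpose, hXsX t htI, hXsX s hsI]
      have h1 := frobNorm_le_of_entry_le (A := X t - X s) fun i k => hXL s t hst i k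
      have h2 := hRL s t hs hst
      have h3 := mul_le_mul_of_nonneg_right (le_max_left (3 * (C : ℝ) + L) C) (sub_nonneg.2 hst)
      linarith
    · intro i
      have h3 := mul_le_mul_of_nonneg_right (le_max_right (3 * (C : ℝ) + L) C) (sub_nonneg.2 hst)
      refine le_trans (le_of_eq ?_) ((hvL s t hst i).trans h3)
      rw [abs_sub_comm]
      simp
  · intro t ht
    rw [hcancel]
    exact compl_jumpSet_subset_flowSet (hKΨ _ (hXsK t ht)).1
  · filter_upwards [hRd] with t hR ht
    have htI := Set.Ioo_subset_Icc_self ht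
    have htI₀ : t ∈ Set.Ioo T (T + ε₀) := ⟨ht.1, ht.2.trans_le (by linarith [min_le_left ε₀ (η / 2)])⟩
    replace hR := hR ht.1
    have hRct : Rc t = R t := by simp only [hRcdef, max_eq_right ht.1.le]
    simp only [FlowsAt, hcancel]
    have hinn : innovation P.Φ (Xs t) ((Xs t)⁻¹ * R t) q =
        (R t : Mat3)ᵀ *ᵥ (X t *ᵥ Ψ (X t)) := by
      rw [innovation, ← (hKΨ _ (hXsK t htI)).2, hXsX t htI, Matrix.mulVec_mulVec]
      congr 1
      change ((Xs t : Mat3)ᵀ * (R t : Mat3))ᵀ = _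
      rw [Matrix.transpose_mul, Matrix.transpose_transpose, hXsX t htI]
    constructor
    · intro i k
      have hprod := hasDerivAt_mul_entry (A := fun s => (X s)ᵀ) (B := fun s => (R s : Mat3))
        (A' := (-(X t * hat (ζ t (y t))))ᵀ) (fun i k => hXd t htI₀ k i) hR i k
      have hev : (fun s => (((Xs s)⁻¹ * R s : SO3) : Mat3) i k) =ᶠ[𝓝 t]
          fun s => ((X s)ᵀ * (R s : Mat3)) i k := by
        filter_upwards [Ioo_mem_nhds ht.1 ht.2] with s hs
        change ((Xs s : Mat3)ᵀ * (R s : Mat3)) i k = _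
        rw [hXsX s (Set.Ioo_subset_Icc_self hs)]
      refine (hprod.congr_of_eventuallyEq hev).congr_deriv (congrFun (congrFun ?_ i) k)
      set Rn : SO3 := (Xs t)⁻¹ * R t with hRn
      have hRnX : (Rn : Mat3) = (X t)ᵀ * (R t : Mat3) := by
        change (Xs t : Mat3)ᵀ * (R t : Mat3) = _
        rw [hXsX t htI]
      have hζt : (Rn : Mat3)ᵀ *ᵥ ζ t (y t) = v t + P.γP • innovation P.Φ (Xs t) Rn q := by
        rw [hinn]
        simp only [hζ]
        change _ *ᵥ ((X t)ᵀ *ᵥ (Rc t *ᵥ v t) + P.γP • Ψ (X t)) = _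
        rw [Matrix.mulVec_add, Matrix.mulVec_smul, hRct, Matrix.mulVec_mulVec (v t), ← hRnX,
          Matrix.mulVec_mulVec (v t), SO3.transpose_mul, Matrix.one_mulVec, hRnX,
          Matrix.transpose_mul, Matrix.transpose_transpose, Matrix.mulVec_mulVec]
      have hω : (ω t + b) - (b - v t) + P.γP • innovation P.Φ (Xs t) Rn q =
          ω t + (Rn : Mat3)ᵀ *ᵥ ζ t (y t) := by rw [hζt]; abel
      change (_ : Mat3) = _
      rw [hω, hat_add (ω t), SO3.hat_transpose_mulVec, Matrix.mul_add, Matrix.mul_assoc (Rn : Mat3)ᵀ,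
        SO3.mul_transpose_cancel_left, hRnX, Matrix.transpose_neg, Matrix.transpose_mul,
        hat_transpose]
      noncomm_ring
    · intro i
      rw [hinn]
      refine ((hvd t htI₀ i).const_sub (b i)).congr_deriv ?_
      rw [hRct]; rfl

end

section

variable {Q : Type*} {P : Design Q} {D : Set (SO3 × Q)} {α₁ α₂ α₃ α₄ c t₀ : ℝ}
  {ω : ℝ → Fin 3 → ℝ} {b : Fin 3 → ℝ} {R : ℝ → SO3} {x : Arc Q} {B : ℝ}

/-! ### Extension of solutions and completeness -/

/-- The hybrid time domain with jump times `τ 1, …, τ J` and last interval `I`. -/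
def finiteDomain (τ : ℕ → ℝ) (J : ℕ) (I : Set ℝ) : Set (ℝ × ℕ) :=
  {p | (p.2 < J ∧ p.1 ∈ Set.Icc (τ p.2) (τ (p.2 + 1))) ∨ (p.2 = J ∧ p.1 ∈ I)}

theorem isHybridTimeDomain_finiteDomain {τ : ℕ → ℝ} (hτ : Monotone τ) {J : ℕ} {T : ℝ}
    (hT : τ J ≤ T) : IsHybridTimeDomain (τ 0) (finiteDomain τ J (Set.Icc (τ J) T)) := by
  refine ⟨fun i => if i ≤ J then τ i else T, fun i k hik => ?_, by simp, Or.inr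
    ⟨J, Set.Icc (τ J) T, Or.inl (by simp), ?_⟩⟩
  · dsimp only
    split_ifs with h1 h2 h2
    · exact hτ hik
    · exact (hτ h1).trans hT
    · exact absurd (hik.trans h2) h1
    · exact le_rfl
  · ext ⟨t, j⟩
    refine or_congr (and_congr_right fun hj => ?_) Iff.rfl
    have hj' : j < J := hj
    simp [hj'.le, Nat.succ_le_of_lt hj']

theorem locAC_of_abs_sub_le {ι : Type*} {f : ℝ → ι → ℝ} {a d C : ℝ}
    (h : ∀ i, ∀ s t, a ≤ s → s ≤ t → t ≤ d → |f t i - f s i| ≤ C * (t - s)) :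
    LocAC (Set.Icc a d) f := by
  intro i s hs t ht
  rcases le_total s t with hst | hst
  · exact absolutelyContinuousOnInterval_of_abs_sub_le hst fun u hu v hv huv =>
      h i u v (hs.1.trans hu.1) huv (hv.2.trans ht.2)
  · exact (absolutelyContinuousOnInterval_of_abs_sub_le hst fun u hu v hv huv =>
      h i u v (ht.1.trans hu.1) huv (hv.2.trans hs.2)).symm

/-- A solution whose last flow interval can be prolonged is not maximal. -/
theorem not_isMaximal_of_longer_flow (h : IsSolution P t₀ ω b R x) {τ : ℕ → ℝ} (hτ : Monotone τ)
    (hτ0 : τ 0 = t₀) {J : ℕ} {I : Set ℝ} (hdom : x.dom = finiteDomain τ J I) (hI : τ J ∈ I)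
    {T : ℝ} (hIT : I ⊆ Set.Icc (τ J) T) (hT : T ∉ I) {Rh' : ℝ → SO3} {bh' : ℝ → Fin 3 → ℝ}
    (hRh : ∀ t ∈ I, Rh' t = x.Rh t J) (hbh : ∀ t ∈ I, bh' t = x.bh t J) {C : ℝ}
    (hLip : ∀ s t, τ J ≤ s → s ≤ t → t ≤ T →
      frobNorm ((Rh' t : Mat3) - (Rh' s : Mat3)) ≤ C * (t - s) ∧
      ∀ i, |bh' t i - bh' s i| ≤ C * (t - s))
    (hflow : ∀ t ∈ Set.Ioo (τ J) T, (R t * (Rh' t)⁻¹, x.q (τ J) J) ∈ flowSet P.Φ P.δ)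
    (hode : ∀ᵐ t : ℝ, t ∈ Set.Ioo (τ J) T → FlowsAt P ω b R (x.q (τ J) J) Rh' bh' t) :
    ¬ IsMaximal P t₀ ω b R x := by
  intro hmax
  have hJT : τ J ≤ T := (hIT hI).2
  let y : Arc Q :=
    { dom := finiteDomain τ J (Set.Icc (τ J) T)
      Rh := fun t j => if j = J then Rh' t else x.Rh t j
      bh := fun t j => if j = J then bh' t else x.bh t j
      q := fun t j => if j = J then x.q (τ J) J else x.q t j }
  have hsJ : y.slice J = Set.Icc (τ J) T := by
    ext t
    change (t, J) ∈ finiteDomain τ J (Set.Icc (τ J) T) ↔ _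
    simp [finiteDomain]
  have hsne : ∀ j, j ≠ J → y.slice j = x.slice j := by
    intro j hj
    ext t
    change (t, j) ∈ finiteDomain τ J (Set.Icc (τ J) T) ↔ (t, j) ∈ x.dom
    rw [hdom]
    simp [finiteDomain, hj]
  have hyR : (y.Rh · J) = Rh' := by ext t; simp [y]
  have hyb : (y.bh · J) = bh' := by ext t; simp [y]
  have hyq : ∀ t, y.q t J = x.q (τ J) J := fun t => by simp [y]
  have hyRne : ∀ j, j ≠ J → ∀ t, y.Rh t j = x.Rh t j := fun j hj t => by simp [y, hj]
  have hybne : ∀ j, j ≠ J → ∀ t, y.bh t j = x.bh t j := fun j hj t => by simp [y, hj]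
  have hyqne : ∀ j, j ≠ J → ∀ t, y.q t j = x.q t j := fun j hj t => by simp [y, hj]
  have hxI : ∀ t, (t, J) ∈ x.dom ↔ t ∈ I := fun t => by rw [hdom]; simp [finiteDomain]
  have hext : y.Extends x := by
    refine ⟨fun ⟨t, j⟩ ht => ?_, fun ⟨t, j⟩ ht => ?_⟩
    · rw [hdom] at ht
      exact ht.imp_right fun ht => ⟨ht.1, hIT ht.2⟩
    · by_cases hj : j = J
      · subst hj
        have htI := (hxI t).1 ht
        exact ⟨(congrFun hyR t).trans (hRh t htI), (congrFun hyb t).trans (hbh t htI),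
          (hyq t).trans (h.flow_q j _ ((hxI _).2 hI) _ ht)⟩
      · exact ⟨hyRne j hj t, hybne j hj t, hyqne j hj t⟩
  have hjump : ∀ t j, (t, j) ∈ y.dom → (t, j + 1) ∈ y.dom →
      (t, j) ∈ x.dom ∧ (t, j + 1) ∈ x.dom := by
    intro t j h1 h2
    have hj : j < J := by
      rcases h2 with h2 | h2
      · exact j.lt_succ_self.trans h2.1
      · exact j.lt_succ_self.trans_eq h2.1
    have h1' : (t, j) ∈ x.dom := (hsne j hj.ne).subset h1
    refine ⟨h1', ?_⟩
    by_cases hj1 : j + 1 = J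
    · subst hj1
      have ht1 : τ (j + 1) ≤ t := (hsJ.subset h2).1
      have ht2 : t ≤ τ (j + 1) := by
        rcases h1 with h1 | h1
        · exact h1.2.2
        · exact absurd h1.1 hj.ne
      rw [le_antisymm ht2 ht1]
      exact (hxI _).2 hI
    · exact (hsne (j + 1) hj1).subset h2
  have hsol : IsSolution P t₀ ω b R y := by
    have hRt : ∀ t j, j ≠ J → y.Rt R t j = x.Rt R t j := fun t j hj => by
      rw [Arc.Rt, Arc.Rt, hyRne j hj]
    have hRtJ : ∀ t, y.Rt R t J = R t * (Rh' t)⁻¹ := fun t => by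
      rw [Arc.Rt, congrFun hyR t]
    have hRtx : ∀ t j, (t, j) ∈ x.dom → y.Rt R t j = x.Rt R t j := fun t j ht => by
      rw [Arc.Rt, Arc.Rt, (hext.2 _ ht).1]
    have hodeJ : ∀ᵐ t : ℝ, t ∈ interior (y.slice J) →
        FlowsAt P ω b R (x.q (τ J) J) (y.Rh · J) (y.bh · J) t := by
      rw [hsJ, interior_Icc, hyR, hyb]
      exact hode
    refine
      { dom := hτ0 ▸ isHybridTimeDomain_finiteDomain hτ hJT
        ac_Rh := fun j => ?_
        ac_bh := fun j => ?_
        flow_mem := fun j t ht => ?_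
        flow_Rh := fun j => ?_
        flow_bh := fun j => ?_
        flow_q := fun j s hs t ht => ?_
        jump_mem := fun t j h1 h2 => ?_
        jump_Rh := fun t j h1 h2 => ?_
        jump_bh := fun t j h1 h2 => ?_
        jump_q := fun t j h1 h2 => ?_ }
    · by_cases hj : j = J
      · subst hj
        rw [hsJ]
        refine locAC_of_abs_sub_le (C := C) fun i s t hs hst ht => ?_
        have := (abs_entry_le_frobNorm _ i.1 i.2).trans (hLip s t hs hst ht).1
        rw [← congrFun hyR s, ← congrFun hyR t] at this
        exact this
      · rw [hsne j hj]
        simp only [hyRne j hj]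
        exact h.ac_Rh j
    · by_cases hj : j = J
      · subst hj
        rw [hsJ]
        refine locAC_of_abs_sub_le (C := C) fun i s t hs hst ht => ?_
        have := (hLip s t hs hst ht).2 i
        rw [← congrFun hyb s, ← congrFun hyb t] at this
        exact this
      · rw [hsne j hj]
        simp only [hybne j hj]
        exact h.ac_bh j
    · by_cases hj : j = J
      · subst hj
        rw [hsJ, interior_Icc] at ht
        rw [hRtJ, hyq]
        exact hflow t ht
      · rw [hsne j hj] at ht
        rw [hRt t j hj, hyqne j hj]
        exact h.flow_mem j t ht
    · by_cases hj : j = J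
      · subst hj
        filter_upwards [hodeJ] with t ht htm
        rw [hyq]
        exact (ht htm).1
      · rw [hsne j hj]
        simp only [hRt _ j hj, hyRne j hj, hybne j hj, hyqne j hj]
        exact h.flow_Rh j
    · by_cases hj : j = J
      · subst hj
        filter_upwards [hodeJ] with t ht htm
        rw [hyq]
        exact (ht htm).2
      · rw [hsne j hj]
        simp only [hRt _ j hj, hyRne j hj, hybne j hj, hyqne j hj]
        exact h.flow_bh j
    · by_cases hj : j = J
      · subst hj
        rw [hyq, hyq]
      · rw [hsne j hj] at hs ht
        rw [hyqne j hj, hyqne j hj]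
        exact h.flow_q j s hs t ht
    · obtain ⟨h1, h2⟩ := hjump t j h1 h2
      rw [hRtx t j h1, (hext.2 _ h1).2.2]
      exact h.jump_mem t j h1 h2
    · obtain ⟨h1, h2⟩ := hjump t j h1 h2
      exact ((hext.2 _ h2).1.trans (h.jump_Rh t j h1 h2)).trans (hext.2 _ h1).1.symm
    · obtain ⟨h1, h2⟩ := hjump t j h1 h2
      exact ((hext.2 _ h2).2.1.trans (h.jump_bh t j h1 h2)).trans (hext.2 _ h1).2.1.symm
    · obtain ⟨h1, h2⟩ := hjump t j h1 h2
      rw [hRtx t j h1, (hext.2 _ h2).2.2]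
      exact h.jump_q t j h1 h2
  have hT' : (T, J) ∈ y.dom := Or.inr ⟨rfl, hJT, le_rfl⟩
  rw [hmax y hsol hext] at hT'
  exact hT ((hxI T).1 hT')

/-- A solution that ends in the jump set is not maximal. -/
theorem not_isMaximal_of_mem_jumpSet [Finite Q] (h : IsSolution P t₀ ω b R x) {τ : ℕ → ℝ}
    (hτ : Monotone τ) (hτ0 : τ 0 = t₀) {J : ℕ} {T : ℝ} (hJT : τ J ≤ T)
    (hdom : x.dom = finiteDomain τ J (Set.Icc (τ J) T))
    (hT : (x.Rt R T J, x.q T J) ∈ jumpSet P.Φ P.δ) : ¬ IsMaximal P t₀ ω b R x := by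
  intro hmax
  have hQ : Nonempty Q := ⟨x.q T J⟩
  obtain ⟨p, hp⟩ := Finite.exists_min (fun p => P.Φ (x.Rt R T J) p)
  let y : Arc Q :=
    { dom := x.dom ∪ {(T, J + 1)}
      Rh := fun t j => if j = J + 1 then x.Rh T J else x.Rh t j
      bh := fun t j => if j = J + 1 then x.bh T J else x.bh t j
      q := fun t j => if j = J + 1 then p else x.q t j }
  have hxJ : ∀ t, (t, J + 1) ∉ x.dom := fun t ht => by
    rw [hdom] at ht
    rcases ht with ht | ht
    · exact absurd ht.1 (Nat.not_succ_lt_self)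
    · exact absurd ht.1 (Nat.succ_ne_self J)
  have hxle : ∀ t j, (t, j) ∈ x.dom → j ≤ J := fun t j ht => by
    rw [hdom] at ht
    exact ht.elim (fun ht => ht.1.le) fun ht => ht.1.le
  have hsJ : y.slice (J + 1) = {T} := by
    ext t
    change (t, J + 1) ∈ x.dom ∪ {(T, J + 1)} ↔ _
    simp [hxJ]
  have hsne : ∀ j, j ≠ J + 1 → y.slice j = x.slice j := by
    intro j hj
    ext t
    change (t, j) ∈ x.dom ∪ {(T, J + 1)} ↔ (t, j) ∈ x.dom
    simp [hj]
  have hyRne : ∀ j, j ≠ J + 1 → ∀ t, y.Rh t j = x.Rh t j := fun j hj t => by simp [y, hj]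
  have hybne : ∀ j, j ≠ J + 1 → ∀ t, y.bh t j = x.bh t j := fun j hj t => by simp [y, hj]
  have hyqne : ∀ j, j ≠ J + 1 → ∀ t, y.q t j = x.q t j := fun j hj t => by simp [y, hj]
  have hyR : ∀ t, y.Rh t (J + 1) = x.Rh T J := fun t => by simp [y]
  have hyb : ∀ t, y.bh t (J + 1) = x.bh T J := fun t => by simp [y]
  have hyq : ∀ t, y.q t (J + 1) = p := fun t => by simp [y]
  have hext : y.Extends x := by
    refine ⟨Set.subset_union_left, fun ⟨t, j⟩ ht => ?_⟩
    have hj : j ≠ J + 1 := ((hxle t j ht).trans_lt J.lt_succ_self).ne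
    exact ⟨hyRne j hj t, hybne j hj t, hyqne j hj t⟩
  have hRt : ∀ t j, j ≠ J + 1 → y.Rt R t j = x.Rt R t j := fun t j hj => by
    rw [Arc.Rt, Arc.Rt, hyRne j hj]
  have hjump : ∀ t j, (t, j) ∈ y.dom → (t, j + 1) ∈ y.dom → j ≠ J + 1 ∧
      (((t, j) ∈ x.dom ∧ (t, j + 1) ∈ x.dom ∧ j + 1 ≠ J + 1) ∨ (t = T ∧ j = J)) := by
    intro t j h1 h2
    rcases h2 with h2 | h2
    · have hj := hxle t _ h2
      have hj1 : j ≠ J + 1 := by omega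
      exact ⟨hj1, Or.inl ⟨(hsne j hj1).subset h1, h2, by omega⟩⟩
    · rw [Set.mem_singleton_iff, Prod.mk.injEq] at h2
      exact ⟨by omega, Or.inr ⟨h2.1, by omega⟩⟩
  have hydom : IsHybridTimeDomain t₀ y.dom := by
    have h1 := isHybridTimeDomain_finiteDomain (τ := fun i => if i ≤ J then τ i else T)
      (J := J + 1) (T := T) (fun i k hik => by
        dsimp only
        split_ifs with h1 h2 h2
        · exact hτ hik
        · exact (hτ h1).trans hJT
        · exact absurd (hik.trans h2) h1
        · exact le_rfl) (by simp)
    simp only [Nat.zero_le, if_true, hτ0] at h1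
    convert h1 using 1
    change x.dom ∪ {(T, J + 1)} = _
    rw [hdom]
    ext ⟨t, j⟩
    simp only [finiteDomain, Set.mem_union, Set.mem_ofPred_eq, Set.mem_singleton_iff, Prod.mk.injEq,
      Nat.lt_succ_iff, Nat.not_succ_le_self, if_false, Set.Icc_self]
    rcases lt_trichotomy j J with hj | rfl | hj
    · simp [hj, hj.le, hj.ne, Nat.succ_le_of_lt hj, (hj.trans J.lt_succ_self).ne]
    · simp
    · simp [hj.not_gt, hj.ne', hj.not_ge, and_comm]
  have hsol : IsSolution P t₀ ω b R y := by
    refine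
      { dom := hydom
        ac_Rh := fun j => ?_
        ac_bh := fun j => ?_
        flow_mem := fun j t ht => ?_
        flow_Rh := fun j => ?_
        flow_bh := fun j => ?_
        flow_q := fun j s hs t ht => ?_
        jump_mem := fun t j h1 h2 => ?_
        jump_Rh := fun t j h1 h2 => ?_
        jump_bh := fun t j h1 h2 => ?_
        jump_q := fun t j h1 h2 => ?_ }
    · by_cases hj : j = J + 1
      · subst hj
        simp only [hyR]
        exact fun i s _ t _ => absolutelyContinuousOnInterval_const _
      · rw [hsne j hj]
        simp only [hyRne j hj]
        exact h.ac_Rh j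
    · by_cases hj : j = J + 1
      · subst hj
        simp only [hyb]
        exact fun i s _ t _ => absolutelyContinuousOnInterval_const _
      · rw [hsne j hj]
        simp only [hybne j hj]
        exact h.ac_bh j
    · by_cases hj : j = J + 1
      · subst hj
        rw [hsJ, interior_singleton] at ht
        exact absurd ht (Set.notMem_empty t)
      · rw [hsne j hj] at ht
        rw [hRt t j hj, hyqne j hj]
        exact h.flow_mem j t ht
    · by_cases hj : j = J + 1
      · subst hj
        rw [hsJ, interior_singleton]
        exact Eventually.of_forall fun t ht => absurd ht (Set.notMem_empty t)
      · rw [hsne j hj]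
        simp only [hRt _ j hj, hyRne j hj, hybne j hj, hyqne j hj]
        exact h.flow_Rh j
    · by_cases hj : j = J + 1
      · subst hj
        rw [hsJ, interior_singleton]
        exact Eventually.of_forall fun t ht => absurd ht (Set.notMem_empty t)
      · rw [hsne j hj]
        simp only [hRt _ j hj, hyRne j hj, hybne j hj, hyqne j hj]
        exact h.flow_bh j
    · by_cases hj : j = J + 1
      · subst hj
        rw [hyq, hyq]
      · rw [hsne j hj] at hs ht
        rw [hyqne j hj, hyqne j hj]
        exact h.flow_q j s hs t ht
    · obtain ⟨hj, ⟨h1, h2, -⟩ | ⟨rfl, rfl⟩⟩ := hjump t j h1 h2 <;> rw [hRt _ _ hj, hyqne _ hj]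
      · exact h.jump_mem t j h1 h2
      · exact hT
    · obtain ⟨hj, ⟨h1, h2, hj1⟩ | ⟨rfl, rfl⟩⟩ := hjump t j h1 h2 <;> rw [hyRne _ hj]
      · rw [hyRne _ hj1]
        exact h.jump_Rh t j h1 h2
      · exact hyR _
    · obtain ⟨hj, ⟨h1, h2, hj1⟩ | ⟨rfl, rfl⟩⟩ := hjump t j h1 h2 <;> rw [hybne _ hj]
      · rw [hybne _ hj1]
        exact h.jump_bh t j h1 h2
      · exact hyb _
    · obtain ⟨hj, ⟨h1, h2, hj1⟩ | ⟨rfl, rfl⟩⟩ := hjump t j h1 h2 <;> rw [hRt _ _ hj]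
      · rw [hyqne _ hj1]
        exact h.jump_q t j h1 h2
      · rw [hyq]
        exact hp
  have hT' : (T, J + 1) ∈ y.dom := Or.inr rfl
  rw [hmax y hsol hext] at hT'
  exact hxJ T hT'

theorem IsSolution.flowsAt (h : IsSolution P t₀ ω b R x) (j : ℕ) {s : ℝ} (hs : s ∈ x.slice j) :
    ∀ᵐ t : ℝ, t ∈ interior (x.slice j) →
      FlowsAt P ω b R (x.q s j) (x.Rh · j) (x.bh · j) t := by
  filter_upwards [h.flow_Rh j, h.flow_bh j] with t h1 h2 ht
  rw [h.flow_q j s hs t (interior_subset ht)]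
  exact ⟨h1 ht, h2 ht⟩

/-- Along a slice on which the bias error is bounded, the estimates are Lipschitz. -/
theorem IsRun.exists_lipschitz (hP : Admissible P D α₁ α₂ α₃ α₄) (h : IsRun P c t₀ ω b R x)
    (hB : ∀ t j, (t, j) ∈ x.dom → euclNorm (b - x.bh t j) ≤ B) (j : ℕ) :
    ∃ C, ∀ s ∈ x.slice j, ∀ t ∈ x.slice j, s ≤ t →
      frobNorm ((x.Rh t j : Mat3) - (x.Rh s j : Mat3)) ≤ C * (t - s) ∧
      ∀ i, |x.bh t j i - x.bh s j i| ≤ C * (t - s) := by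
  refine ⟨max (3 * (Real.sqrt 2 * (c + B + P.γP * (Real.sqrt (α₄ / 2) * 2))))
    (P.γI * (Real.sqrt (α₄ / 2) * 2)), fun s hs t ht hst => ⟨?_, fun i => ?_⟩⟩
  · refine (h.estimate_lipschitz hP hs ht hst fun r hr => hB r j
      (Icc_subset_slice h.solution.dom hs ht hr)).trans ?_
    exact mul_le_mul_of_nonneg_right (le_max_left _ _) (sub_nonneg.2 hst)
  · exact (h.bias_lipschitz hP hs ht hst i).trans
      (mul_le_mul_of_nonneg_right (le_max_right _ _) (sub_nonneg.2 hst))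

/-- A solution whose last flow interval is bounded and half-open is not maximal: the estimates have
limits at the right end point. -/
theorem not_isMaximal_of_Ico (hP : Admissible P D α₁ α₂ α₃ α₄) (h : IsRun P c t₀ ω b R x)
    (hB : ∀ t j, (t, j) ∈ x.dom → euclNorm (b - x.bh t j) ≤ B) {τ : ℕ → ℝ} (hτ : Monotone τ)
    (hτ0 : τ 0 = t₀) {J : ℕ} {T : ℝ} (hJT : τ J < T)
    (hdom : x.dom = finiteDomain τ J (Set.Ico (τ J) T)) : ¬ IsMaximal P t₀ ω b R x := by
  obtain ⟨C, hC⟩ := h.exists_lipschitz hP hB J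
  have hslice : x.slice J = Set.Ico (τ J) T := by
    ext t
    change (t, J) ∈ x.dom ↔ _
    rw [hdom]; simp [finiteDomain]
  rw [hslice] at hC
  have hG : ∀ i k, ∃ g : ℝ → ℝ, LipschitzWith C.toNNReal g ∧
      Set.EqOn (fun t => (x.Rh t J : Mat3) i k) g (Set.Ico (τ J) T) := fun i k =>
    (lipschitzOnWith_of_abs_sub_le fun s hs t ht hst =>
      (abs_entry_le_frobNorm _ i k).trans (hC s hs t ht hst).1).extend_real
  have hg : ∀ i, ∃ g : ℝ → ℝ, LipschitzWith C.toNNReal g ∧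
      Set.EqOn (fun t => x.bh t J i) g (Set.Ico (τ J) T) := fun i =>
    (lipschitzOnWith_of_abs_sub_le fun s hs t ht hst => (hC s hs t ht hst).2 i).extend_real
  choose G hGL hGe using hG
  choose g hgL hge using hg
  set A : ℝ → Mat3 := fun t => Matrix.of fun i k => G i k t with hA
  have hAc : Continuous A := continuous_matrix fun i k => (hGL i k).continuous
  have hAe : ∀ t ∈ Set.Ico (τ J) T, A t = x.Rh t J := fun t ht => by
    ext i k; exact (hGe i k ht).symm
  have hAmem : ∀ t ∈ Set.Icc (τ J) T, A t ∈ specialOrthogonalGroup (Fin 3) ℝ := by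
    have h1 : Set.Ico (τ J) T ⊆ A ⁻¹' {A | A ∈ specialOrthogonalGroup (Fin 3) ℝ} := fun t ht => by
      rw [Set.mem_preimage, hAe t ht]; exact (x.Rh t J).2
    have h2 := closure_minimal h1 (isClosed_SO3.preimage hAc)
    rw [closure_Ico hJT.ne] at h2
    exact h2
  classical
  set Rh' : ℝ → SO3 := fun t =>
    if h : A t ∈ specialOrthogonalGroup (Fin 3) ℝ then ⟨A t, h⟩ else 1 with hRh'
  have hRhA : ∀ t ∈ Set.Icc (τ J) T, (Rh' t : Mat3) = A t := fun t ht => by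
    simp only [hRh', dif_pos (hAmem t ht)]
  have hRhx : ∀ t ∈ Set.Ico (τ J) T, Rh' t = x.Rh t J := fun t ht =>
    Subtype.ext ((hRhA t (Set.Ico_subset_Icc_self ht)).trans (hAe t ht))
  have hbhx : ∀ t ∈ Set.Ico (τ J) T, (fun i => g i t) = x.bh t J := fun t ht =>
    funext fun i => (hge i ht).symm
  have hJ : τ J ∈ Set.Ico (τ J) T := ⟨le_rfl, hJT⟩
  refine not_isMaximal_of_longer_flow h.solution hτ hτ0 hdom hJ Set.Ico_subset_Icc_self
    (fun hT => hT.2.false) (Rh' := Rh') (bh' := fun t i => g i t) hRhx hbhx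
    (C := 3 * C.toNNReal) ?_ ?_ ?_
  · intro s t hs hst ht
    have hlip : ∀ g : ℝ → ℝ, LipschitzWith C.toNNReal g → |g t - g s| ≤ C.toNNReal * (t - s) :=
      fun g hg => by
        have := hg.dist_le_mul t s
        rwa [Real.dist_eq, Real.dist_eq, abs_of_nonneg (sub_nonneg.2 hst)] at this
    constructor
    · rw [hRhA s ⟨hs, hst.trans ht⟩, hRhA t ⟨hs.trans hst, ht⟩, mul_assoc]
      exact frobNorm_le_of_entry_le fun i k => hlip _ (hGL i k)
    · intro i
      refine (hlip _ (hgL i)).trans ?_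
      have : 0 ≤ (C.toNNReal : ℝ) * (t - s) :=
        mul_nonneg C.toNNReal.2 (sub_nonneg.2 hst)
      linarith
  · intro t ht
    rw [hRhx t (Set.Ioo_subset_Ico_self ht)]
    have hint : t ∈ interior (x.slice J) := by rwa [hslice, interior_Ico]
    have := h.solution.flow_mem J t hint
    rwa [h.solution.flow_q J t (interior_subset hint) (τ J) (hslice ▸ hJ)] at this
  · filter_upwards [h.solution.flowsAt J (s := τ J) (hslice ▸ hJ)] with t ht htm
    have hint : t ∈ interior (x.slice J) := by rwa [hslice, interior_Ico]
    refine (ht hint).congr ?_ ?_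
    · filter_upwards [Ioo_mem_nhds htm.1 htm.2] with s hs
      exact hRhx s (Set.Ioo_subset_Ico_self hs)
    · filter_upwards [Ioo_mem_nhds htm.1 htm.2] with s hs
      exact hbhx s (Set.Ioo_subset_Ico_self hs)

/-- A solution whose last flow interval is compact is not maximal: it can jump or flow further. -/
theorem not_isMaximal_of_Icc [Finite Q] (hP : Admissible P D α₁ α₂ α₃ α₄)
    (h : IsRun P c t₀ ω b R x)
    (hB : ∀ t j, (t, j) ∈ x.dom → euclNorm (b - x.bh t j) ≤ B) {τ : ℕ → ℝ} (hτ : Monotone τ)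
    (hτ0 : τ 0 = t₀) {J : ℕ} {T : ℝ} (hJT : τ J ≤ T)
    (hdom : x.dom = finiteDomain τ J (Set.Icc (τ J) T)) : ¬ IsMaximal P t₀ ω b R x := by
  by_cases hjump : (x.Rt R T J, x.q T J) ∈ jumpSet P.Φ P.δ
  · exact not_isMaximal_of_mem_jumpSet h.solution hτ hτ0 hJT hdom hjump
  obtain ⟨C, hC⟩ := h.exists_lipschitz hP hB J
  have hslice : x.slice J = Set.Icc (τ J) T := by
    ext t
    change (t, J) ∈ x.dom ↔ _
    rw [hdom]; simp [finiteDomain]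
  have hJ : τ J ∈ x.slice J := hslice ▸ ⟨le_rfl, hJT⟩
  have hTx : T ∈ x.slice J := hslice ▸ ⟨hJT, le_rfl⟩
  have ht₀T : t₀ ≤ T := h.solution.dom.le_of_mem hTx
  rw [hslice] at hC
  obtain ⟨ε, hε, C', Rn, bn, hRnT, hbnT, hLip, hflow, hode⟩ := exists_local_flow hP
    (T := T) (ω := ω) (h.attitude_continuousOn.mono (Set.Ici_subset_Ici.2 ht₀T))
    (fun s t hs hst => h.attitude_lipschitz (ht₀T.trans hs) hst)
    (by filter_upwards [h.attitude.deriv] with t ht htT using ht (ht₀T.trans_lt htT))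
    b (x.Rh T J) (x.bh T J) (x.q T J) hjump
  rw [h.solution.flow_q J T hTx _ hJ] at hflow hode
  set Rh' : ℝ → SO3 := fun t => if t ≤ T then x.Rh t J else Rn t with hRh'
  set bh' : ℝ → Fin 3 → ℝ := fun t => if t ≤ T then x.bh t J else bn t with hbh'
  have hR1 : ∀ t, t ≤ T → Rh' t = x.Rh t J := fun t ht => if_pos ht
  have hb1 : ∀ t, t ≤ T → bh' t = x.bh t J := fun t ht => if_pos ht
  have hR2 : ∀ t, T ≤ t → Rh' t = Rn t := fun t ht => by
    rcases ht.eq_or_lt with rfl | ht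
    · rw [hR1 _ le_rfl, hRnT]
    · exact if_neg ht.not_ge
  have hb2 : ∀ t, T ≤ t → bh' t = bn t := fun t ht => by
    rcases ht.eq_or_lt with rfl | ht
    · rw [hb1 _ le_rfl, hbnT]
    · exact if_neg ht.not_ge
  refine not_isMaximal_of_longer_flow h.solution hτ hτ0 hdom ⟨le_rfl, hJT⟩ (T := T + ε)
    (Set.Icc_subset_Icc_right (by linarith)) (fun hT => by linarith [hT.2])
    (Rh' := Rh') (bh' := bh') (fun t ht => hR1 t ht.2) (fun t ht => hb1 t ht.2)
    (C := max C C') ?_ ?_ ?_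
  · have h1 : ∀ s t, τ J ≤ s → s ≤ t → t ≤ T →
        frobNorm ((Rh' t : Mat3) - (Rh' s : Mat3)) ≤ max C C' * (t - s) ∧
          ∀ i, |bh' t i - bh' s i| ≤ max C C' * (t - s) := by
      intro s t hs hst ht
      rw [hR1 s (hst.trans ht), hR1 t ht, hb1 s (hst.trans ht), hb1 t ht]
      have := hC s ⟨hs, hst.trans ht⟩ t ⟨hs.trans hst, ht⟩ hst
      have hm := mul_le_mul_of_nonneg_right (le_max_left C C') (sub_nonneg.2 hst)
      exact ⟨this.1.trans hm, fun i => (this.2 i).trans hm⟩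
    have h2 : ∀ s t, T ≤ s → s ≤ t → t ≤ T + ε →
        frobNorm ((Rh' t : Mat3) - (Rh' s : Mat3)) ≤ max C C' * (t - s) ∧
          ∀ i, |bh' t i - bh' s i| ≤ max C C' * (t - s) := by
      intro s t hs hst ht
      rw [hR2 s hs, hR2 t (hs.trans hst), hb2 s hs, hb2 t (hs.trans hst)]
      have := hLip s t hs hst ht
      have hm := mul_le_mul_of_nonneg_right (le_max_right C C') (sub_nonneg.2 hst)
      exact ⟨this.1.trans hm, fun i => (this.2 i).trans hm⟩
    intro s t hs hst ht
    rcases le_total t T with htT | htT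
    · exact h1 s t hs hst htT
    rcases le_total T s with hsT | hsT
    · exact h2 s t hsT hst ht
    obtain ⟨a1, a2⟩ := h1 s T hs hsT le_rfl
    obtain ⟨b1, b2⟩ := h2 T t le_rfl htT ht
    constructor
    · have e : (Rh' t : Mat3) - (Rh' s : Mat3) =
          ((Rh' t : Mat3) - (Rh' T : Mat3)) + ((Rh' T : Mat3) - (Rh' s : Mat3)) := by abel
      rw [e]
      refine (frobNorm_add_le _ _).trans ?_
      linarith
    · intro i
      have := abs_sub_le (bh' t i) (bh' T i) (bh' s i)
      linarith [a2 i, b2 i]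
  · intro t ht
    rcases lt_or_ge t T with htT | htT
    · rw [hR1 t htT.le]
      have hint : t ∈ interior (x.slice J) := by rw [hslice, interior_Icc]; exact ⟨ht.1, htT⟩
      have := h.solution.flow_mem J t hint
      rwa [h.solution.flow_q J t (interior_subset hint) _ hJ] at this
    · rw [hR2 t htT]
      exact hflow t ⟨htT, ht.2.le⟩
  · have hne : ∀ᵐ t : ℝ, t ≠ T := by simp [ae_iff]
    filter_upwards [h.solution.flowsAt J hJ, hode, hne] with t h1 h2 htne ht
    rcases lt_or_gt_of_ne htne with htT | htT
    · have hint : t ∈ interior (x.slice J) := by rw [hslice, interior_Icc]; exact ⟨ht.1, htT⟩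
      refine (h1 hint).congr ?_ ?_ <;> filter_upwards [Iio_mem_nhds htT] with s hs
      · exact hR1 s (le_of_lt hs)
      · exact hb1 s (le_of_lt hs)
    · refine (h2 ⟨htT, ht.2⟩).congr ?_ ?_ <;> filter_upwards [Ioi_mem_nhds htT] with s hs
      · exact hR2 s (le_of_lt hs)
      · exact hb2 s (le_of_lt hs)

theorem complete_of_isMaximal [Finite Q] (hP : Admissible P D α₁ α₂ α₃ α₄)
    (h : IsRun P c t₀ ω b R x)
    (hB : ∀ t j, (t, j) ∈ x.dom → euclNorm (b - x.bh t j) ≤ B) {N : ℕ}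
    (hN : ∀ t j, (t, j) ∈ x.dom → j ≤ N) (hmax : IsMaximal P t₀ ω b R x) : x.Complete := by
  obtain ⟨τ, hτ, hτ0, hdom | ⟨J, I, rfl | ⟨hlt, rfl⟩ | rfl, hdom⟩⟩ := h.solution.dom
  · have : (τ (N + 1), N + 1) ∈ x.dom := by
      rw [hdom]; exact ⟨le_rfl, hτ (N + 1).le_succ⟩
    exact absurd (hN _ _ this) (Nat.not_succ_le_self N)
  · exact absurd hmax (not_isMaximal_of_Icc hP h hB hτ hτ0 (hτ J.le_succ) hdom)
  · exact absurd hmax (not_isMaximal_of_Ico hP h hB hτ hτ0 hlt hdom)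
  · intro M
    refine ⟨(max (τ J) M, J), ?_, ?_⟩
    · rw [hdom]; exact Or.inr ⟨rfl, Set.mem_Ici.2 (le_max_left _ _)⟩
    · have : (0 : ℝ) ≤ J := Nat.cast_nonneg J
      linarith [le_max_right (τ J) M]

end

end HybridObserver

open HybridObserver

theorem theorem1 {Q : Type*} [Finite Q] (P : Design Q) (D : Set (SO3 × Q))
    (hγP : 0 < P.γP) (hγI : 0 < P.γI) (hδ : 0 < P.δ)
    (hΦ : IsPotential D P.Φ) (hD : flowSet P.Φ P.δ ⊆ D)
    (α₁ α₂ α₃ α₄ : ℝ) (hα₁ : 0 < α₁) (hα₂ : 0 < α₂) (hα₃ : 0 < α₃) (hα₄ : 0 < α₄)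
    (hquad : ∀ X q, α₁ * attNorm X ^ 2 ≤ P.Φ X q ∧ P.Φ X q ≤ α₂ * attNorm X ^ 2)
    (hgrad : ∀ X q, (X, q) ∈ flowSet P.Φ P.δ →
      α₃ * attNorm X ^ 2 ≤ frobNorm (gradSO3 (fun Y => P.Φ Y q) X) ^ 2 ∧
      frobNorm (gradSO3 (fun Y => P.Φ Y q) X) ^ 2 ≤ α₄ * attNorm X ^ 2) :
    ∃ k : ℝ, 0 < k ∧ ∀ r c : ℝ, ∃ N : ℕ, ∃ lam : ℝ, 0 < lam ∧
      ∀ (ω : ℝ → Fin 3 → ℝ), (∀ t, 0 ≤ t → euclNorm (ω t) ≤ c) →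
      ∀ (b : Fin 3 → ℝ) (t₀ : ℝ), 0 ≤ t₀ →
      ∀ (R : ℝ → SO3), IsAttitude t₀ ω R →
      ∀ x : Arc Q, IsSolution P t₀ ω b R x → x.errSq R b t₀ 0 ≤ r ^ 2 →
        (∀ t j, (t, j) ∈ x.dom → j ≤ N) ∧
        (∀ t j, (t, j) ∈ x.dom →
          x.errSq R b t j ≤ k * Real.exp (-lam * (t - t₀ + j)) * x.errSq R b t₀ 0) ∧
        (IsMaximal P t₀ ω b R x → x.Complete) := by
  have hP : Admissible P D α₁ α₂ α₃ α₄ :=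
    ⟨hγP, hγI, hδ, hΦ, hD, hα₁, hα₂, hα₃, hα₄, hquad, hgrad⟩
  set m := min α₁ (1 / P.γI) with hm
  set M := max α₂ (1 / P.γI) with hM
  have hm0 : 0 < m := lt_min hα₁ (by positivity)
  have hM0 : 0 < M := lt_max_of_lt_left hα₂
  refine ⟨(2 * M / m + 1) * Real.exp 1, by positivity, fun r c => ?_⟩
  set B := Real.sqrt (P.γI * (M * r ^ 2)) with hB
  obtain ⟨lam₀, hlam₀, hdecay⟩ := exists_errSq_decay hP B c
  set N := ⌈M * r ^ 2 / P.δ⌉₊ with hN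
  -- The rate is at most `1 / (N + 1)`, so that the jumps cost at most the factor `e`.
  refine ⟨N, min lam₀ (1 / (N + 1)), lt_min hlam₀ (by positivity), ?_⟩
  intro ω hω b t₀ ht₀ R hR x hx hr
  have hrun : IsRun P c t₀ ω b R x := ⟨hω, ht₀, hR, hx⟩
  have hE₀ : energy P R b x t₀ 0 ≤ M * r ^ 2 :=
    (energy_le_errSq hP).trans (mul_le_mul_of_nonneg_left hr hM0.le)
  have hE : ∀ t j, (t, j) ∈ x.dom → energy P R b x t j + P.δ * j ≤ M * r ^ 2 := fun t j ht =>
    (energy_le hP hrun ht).trans hE₀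
  have hbias : ∀ t j, (t, j) ∈ x.dom → euclNorm (b - x.bh t j) ≤ B := fun t j ht => by
    refine bias_error_le_of_energy_le (R := R) hP ?_
    have : 0 ≤ P.δ * j := by positivity
    linarith [hE t j ht]
  have hjumps : ∀ t j, (t, j) ∈ x.dom → j ≤ N := fun t j ht => by
    have h0 : 0 ≤ energy P R b x t j := (mul_nonneg hm0.le errSq_nonneg).trans (le_energy hP)
    have h1 : (j : ℝ) ≤ M * r ^ 2 / P.δ := by
      rw [le_div_iff₀ hδ, mul_comm]
      linarith [hE t j ht]
    exact_mod_cast h1.trans (Nat.le_ceil _)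
  refine ⟨hjumps, fun t j ht => ?_, complete_of_isMaximal hP hrun hbias hjumps⟩
  refine (hdecay t₀ ω b R x hrun hbias t j ht).trans ?_
  refine mul_le_mul_of_nonneg_right ?_ errSq_nonneg
  rw [mul_assoc (2 * M / m + 1), ← Real.exp_add]
  refine mul_le_mul_of_nonneg_left (Real.exp_le_exp.2 ?_) (by positivity)
  have ht' : 0 ≤ t - t₀ := sub_nonneg.2 (hx.dom.le_of_mem ht)
  have h1 := mul_le_mul_of_nonneg_right (min_le_left lam₀ (1 / ((N : ℝ) + 1))) ht'
  have h2 : min lam₀ (1 / ((N : ℝ) + 1)) * j ≤ 1 := by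
    have hjN : (j : ℝ) ≤ N + 1 := by exact_mod_cast (hjumps t j ht).trans N.le_succ
    calc _ ≤ 1 / ((N : ℝ) + 1) * (N + 1) :=
          mul_le_mul (min_le_right _ _) hjN (Nat.cast_nonneg j) (by positivity)
      _ = 1 := by field_simp
  linarith
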